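/- Let $n\ge 1$ and $\alpha>-1$. On $\mathbb C^n$ put $\langle z,w\rangle=\sum_j z_j\overline{w_j}$ and $|z|=\sqrt{\langle z,z\rangle}$, let $\mathbb B^n=\{|z|<1\}$, let $v$ be Lebesgue measure, and let $\|\cdot\|_\infty$ be the norm of $L^\infty(\mathbb B^n)=L^\infty(\mathbb B^n,v)$ (complex valued functions). For $f\in L^\infty(\mathbb B^n)$ let $$(B_\alpha f)(z)=c_\alpha\int_{\mathbb B^n}\frac{(1-|z|^2)^{n+1}}{|1-\langle z,w\rangle|^{2n+2}}\,f(w)\,(1-|w|^2)^\alpha\,dv(w),\quad z\in\mathbb B^n,\qquad c_\alpha=\frac{\Gamma(\alpha+n+1)}{\Gamma(\alpha+1)\pi^n}.$$ Let $\nabla_z g=(\partial g/\partial z_1,\dots,\partial g/\partial z_n)$ and $\nabla_{\bar z}g=(\partial g/\partial\overline{z_1},\dots,\partial g/\partial\overline{z_n})$ be the complex gradients, and let $\nabla g=(\partial g/\partial x_1,\partial g/\partial y_1,\dots,\partial g/\partial x_n,\partial g/\partial y_n)$, $z_j=x_j+iy_j$, be the real gradient, all measured in the Euclidean norm. The $C^1$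 Bloch space $\mathcal B$ consists of the $g\in C^1(\mathbb B^n)$ with $\|g\|_{\mathcal B}=|g(0)|+\sup_{|z|<1}(1-|z|^2)|\nabla g(z)|<\infty$. Put $$\|g\|_{(z)}=\sup_{|z|<1}(1-|z|^2)|\nabla_z g(z)|,\qquad \|B_\alpha\|_{*,\mathbb C}=\sup_{\|f\|_\infty\le 1}\|B_\alpha f\|_{(z)}\in[0,\infty].$$ Then $B_\alpha f\in C^1(\mathbb B^n)$ for every $f\in L^\infty(\mathbb B^n)$, and the following holds. (i) If $0\le\alpha\le 2n+3$, then $$\|B_\alpha\|_{*,\mathbb C}=c_\alpha(n+1)\int_{\mathbb B^n}|\zeta_1|(1-|\zeta|^2)^\alpha\,dv(\zeta)=\frac{n+1}{2}\,B\!\left(n+\alpha+1,\tfrac12\right),$$ where $B(\cdot,\cdot)$ is Euler's beta function. Let $\|f\|_\infty=1$ and consider the condition $(E)$: there are $a\in\mathbb C^n$ with $|a|=1$ and $C\in\mathbb C$ with $|C|=1$ such that $f(w)=C\,\dfrac{|\langle w,a\rangle|}{\overline{\langle w,a\rangle}}$ for almost every $w\in\mathbb B^n$. Then $|\nabla_z(B_\alpha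 f)(0)|=\|B_\alpha\|_{*,\mathbb C}$ if and only if $(E)$ holds; in particular $(E)$ implies $\|B_\alpha f\|_{(z)}=\|B_\alpha\|_{*,\mathbb C}$. If moreover $\alpha>0$, then $\|B_\alpha f\|_{(z)}=\|B_\alpha\|_{*,\mathbb C}$ if and only if $(E)$ holds. (ii) If $-1<\alpha<0$, then $\|B_\alpha\|_{*,\mathbb C}=+\infty$, and $B_\alpha$ is not a bounded operator from $L^\infty(\mathbb B^n)$ to $\mathcal B$. (iii) If $\alpha>2n+3$, then $$\|B_\alpha\|_{*,\mathbb C}<(n+1)\,\Gamma(n+\alpha+1)\binom{\alpha+k_\alpha-1}{k_\alpha}\frac{\Gamma\left(k_\alpha+\frac32\right)}{\Gamma\left(k_\alpha+\alpha+n+\frac32\right)},\qquad k_\alpha=\left\lceil\frac{\alpha-(2n+3)}{2n+2}\right\rceil,$$ where $\binom{x}{k}=x(x-1)\cdots(x-k+1)/k!$ and $\lceil x\rceil$ is the smallest non-negative integer not smaller than $x$. All of (i)–(iii) also holds with $\nabla_{\bar z}$ in place of $\nabla_z$ throughout, with the same constants; in $(E)$ the functions are then $f(w)=C\,\dfrac{|\langle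 w,a\rangle|}{\langle w,a\rangle}$. -/

import Mathlib

noncomputable section

namespace BerezinBloch

open MeasureTheory
open scoped ENNReal ComplexConjugate

/-- The space `ℂⁿ` with its Euclidean norm. -/
abbrev Cn (n : ℕ) : Type := EuclideanSpace ℂ (Fin n)

/-- The open unit ball of `ℂⁿ`. -/
def unitBall (n : ℕ) : Set (Cn n) := Metric.ball 0 1

/-- Lebesgue measure on the unit ball. -/
def ballVol (n : ℕ) : Measure (Cn n) := volume.restrict (unitBall n)

/-- The Hermitian product `⟨z, w⟩ = ∑ z_j * conj w_j`, linear in the first variable. -/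
def herm {n : ℕ} (z w : Cn n) : ℂ := ∑ j, z j * conj (w j)

/-- The normalizing constant `c_α = Γ(α+n+1) / (Γ(α+1) π^n)`. -/
def cConst (n : ℕ) (α : ℝ) : ℝ :=
  Real.Gamma (α + n + 1) / (Real.Gamma (α + 1) * Real.pi ^ n)

/-- The Berezin kernel `(1-|z|²)^(n+1) / |1-⟨z,w⟩|^(2n+2)`. -/
def kernel {n : ℕ} (z w : Cn n) : ℝ :=
  (1 - ‖z‖ ^ 2) ^ (n + 1) / ‖1 - herm z w‖ ^ (2 * n + 2)

/-- The weighted Berezin transform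
`(B_α f)(z) = c_α ∫ K(z,w) f(w) (1-|w|²)^α dv(w)`, integrated over the unit ball. -/
def berezin (n : ℕ) (α : ℝ) (f : Cn n → ℂ) (z : Cn n) : ℂ :=
  (cConst n α : ℂ) *
    ∫ w, (kernel z w : ℂ) * f w * (((1 - ‖w‖ ^ 2) ^ α : ℝ) : ℂ) ∂(ballVol n)

/-- `f` belongs to `L^∞` of the unit ball. -/
def MemLinf {n : ℕ} (f : Cn n → ℂ) : Prop := MemLp f ⊤ (ballVol n)

/-- The essential supremum norm over the unit ball. -/
def normLinf {n : ℕ} (f : Cn n → ℂ) : ℝ≥0∞ := eLpNorm f ⊤ (ballVol n)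

/-- `∂g/∂x_j`, where `z_j = x_j + i y_j`. -/
def dx {n : ℕ} (g : Cn n → ℂ) (z : Cn n) (j : Fin n) : ℂ :=
  fderiv ℝ g z (EuclideanSpace.single j (1 : ℂ))

/-- `∂g/∂y_j`, where `z_j = x_j + i y_j`. -/
def dy {n : ℕ} (g : Cn n → ℂ) (z : Cn n) (j : Fin n) : ℂ :=
  fderiv ℝ g z (EuclideanSpace.single j Complex.I)

/-- The complex gradient `(∂g/∂z_1, …, ∂g/∂z_n)`, with `∂/∂z_j = (∂/∂x_j - i ∂/∂y_j) / 2`. -/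
def gradZ {n : ℕ} (g : Cn n → ℂ) (z : Cn n) : Cn n :=
  WithLp.toLp 2 fun j => (dx g z j - Complex.I * dy g z j) / 2

/-- The conjugate complex gradient, with `∂/∂z̄_j = (∂/∂x_j + i ∂/∂y_j) / 2`. -/
def gradZbar {n : ℕ} (g : Cn n → ℂ) (z : Cn n) : Cn n :=
  WithLp.toLp 2 fun j => (dx g z j + Complex.I * dy g z j) / 2

/-- The Euclidean length of the real gradient `(∂g/∂x_1, ∂g/∂y_1, …, ∂g/∂x_n, ∂g/∂y_n)`. -/
def realGradNorm {n : ℕ} (g : Cn n → ℂ) (z : Cn n) : ℝ :=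
  Real.sqrt (∑ j, (‖dx g z j‖ ^ 2 + ‖dy g z j‖ ^ 2))

/-- `sup_{|z|<1} (1-|z|²) |∇_z g(z)|`. -/
def blochZ {n : ℕ} (g : Cn n → ℂ) : ℝ≥0∞ :=
  ⨆ z ∈ unitBall n, ENNReal.ofReal ((1 - ‖z‖ ^ 2) * ‖gradZ g z‖)

/-- `sup_{|z|<1} (1-|z|²) |∇_{z̄} g(z)|`. -/
def blochZbar {n : ℕ} (g : Cn n → ℂ) : ℝ≥0∞ :=
  ⨆ z ∈ unitBall n, ENNReal.ofReal ((1 - ‖z‖ ^ 2) * ‖gradZbar g z‖)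

/-- The norm of the `C¹` Bloch space,
`|g(0)| + sup_{|z|<1} (1-|z|²) |∇g(z)|`, with the real gradient. -/
def blochNorm {n : ℕ} (g : Cn n → ℂ) : ℝ≥0∞ :=
  ENNReal.ofReal ‖g 0‖ +
    ⨆ z ∈ unitBall n, ENNReal.ofReal ((1 - ‖z‖ ^ 2) * realGradNorm g z)

/-- The seminorm of `B_α`:
the supremum of `(1-|z|²) |∇_z (B_α f)(z)|` over `|z| < 1` and `‖f‖_∞ ≤ 1`. -/
def opNormZ (n : ℕ) (α : ℝ) : ℝ≥0∞ :=
  ⨆ (f : Cn n → ℂ) (_ : MemLinf f) (_ : normLinf f ≤ 1), blochZ (berezin n α f)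

/-- The conjugate-derivative seminorm of `B_α`:
the supremum of `(1-|z|²) |∇_{z̄} (B_α f)(z)|` over `|z| < 1` and `‖f‖_∞ ≤ 1`. -/
def opNormZbar (n : ℕ) (α : ℝ) : ℝ≥0∞ :=
  ⨆ (f : Cn n → ℂ) (_ : MemLinf f) (_ : normLinf f ≤ 1), blochZbar (berezin n α f)

/-- `B_α` is a bounded operator from `L^∞` to the `C¹` Bloch space. -/
def IsBoundedToBloch (n : ℕ) (α : ℝ) : Prop :=
  ∃ M : NNReal, ∀ f : Cn n → ℂ, MemLinf f →
    ContDiffOn ℝ 1 (berezin n α f) (unitBall n) ∧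
      blochNorm (berezin n α f) ≤ (M : ℝ≥0∞) * normLinf f

/-- `f(w) = C |⟨w,a⟩| / conj ⟨w,a⟩` almost everywhere on the ball,
for some unit vector `a` and some unimodular constant `C`. -/
def IsExtremalZ {n : ℕ} (f : Cn n → ℂ) : Prop :=
  ∃ (a : Cn n) (C : ℂ), ‖a‖ = 1 ∧ ‖C‖ = 1 ∧
    f =ᵐ[ballVol n] fun w => C * ((‖herm w a‖ : ℂ) / conj (herm w a))

/-- `f(w) = C |⟨w,a⟩| / ⟨w,a⟩` almost everywhere on the ball,
for some unit vector `a` and some unimodular constant `C`. -/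
def IsExtremalZbar {n : ℕ} (f : Cn n → ℂ) : Prop :=
  ∃ (a : Cn n) (C : ℂ), ‖a‖ = 1 ∧ ‖C‖ = 1 ∧
    f =ᵐ[ballVol n] fun w => C * ((‖herm w a‖ : ℂ) / herm w a)

/-- `((n+1)/2) B(n+α+1, 1/2)`, with Euler's beta function. -/
def sharpConst (n : ℕ) (α : ℝ) : ℝ :=
  ((n : ℝ) + 1) / 2 * ProbabilityTheory.beta (n + α + 1) (1 / 2)

/-- `k_α`, the smallest natural number that is at least `(α-(2n+3)) / (2n+2)`. -/
def kIndex (n : ℕ) (α : ℝ) : ℕ := ⌈(α - (2 * n + 3)) / (2 * n + 2)⌉₊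

/-- `(n+1) Γ(n+α+1) binom(α+k-1, k) Γ(k+3/2) / Γ(k+α+n+3/2)` for `k = k_α`,
with the generalized binomial coefficient `x (x-1) ⋯ (x-k+1) / k!`. -/
def upperConst (n : ℕ) (α : ℝ) : ℝ :=
  ((n : ℝ) + 1) * Real.Gamma (n + α + 1) *
    Ring.choose (α + kIndex n α - 1) (kIndex n α) *
    (Real.Gamma (kIndex n α + 3 / 2) / Real.Gamma (kIndex n α + α + n + 3 / 2))

end BerezinBloch

end

open BerezinBloch

/-!
The two families of statements are equivalent: complex conjugation of `f` exchanges `∂/∂z` and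
`∂/∂z̄` as well as the two kinds of extremal functions, so everything is proved for `∇_{z̄}` and
transferred at the end (`norm_gradZ_berezin`, `isExtremalZbar_conj_iff`).

Differentiation under the integral sign gives
`∇_{z̄} (B_α f)(z) = c_α (n + 1) ∫ K(z, w) f(w) G(z, w) (1 - |w|²)^α dv(w)` with
`G(z, w) = w / (1 - ⟨w, z⟩) - z / (1 - |z|²)` (`gradZbar_berezin`).  The kernel `K(z, ·)` is the
real Jacobian of the involutive automorphism `φ_z` of the ball, and
`(1 - |z|²) G(z, φ_z(ζ)) = -A_z ζ` for the self-adjoint contraction `A_z = P + √(1 - |z|²) Q`.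
Pairing with a unit vector `u` and substituting `w = φ_z(ζ)` therefore bounds
`(1 - |z|²) |∇_{z̄} (B_α f)(z)|` by
`c_α (n + 1) (1 - |z|²)^α ∫ |⟨ζ, A_z u⟩| |1 - ⟨ζ, z⟩|^(-2α) (1 - |ζ|²)^α dv(ζ)`
(`integral_kernel_mul_inner`, `exists_gradZbar_berezin_le`), with equality at `z = 0` exactly when
the phase of `f` is opposite to that of `⟨·, u⟩`.

For `α ≥ 0` expand `|1 - ⟨ζ, z⟩|^(-2α)` in powers of `⟨ζ, z⟩` and its conjugate.  Only the diagonal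
terms survive integration (`hasSum_integral_expansion`), and by the inequality of Young
the mixed moment `∫ |⟨ζ, v⟩| |⟨ζ, z⟩|^(2k)` is at most `|v| |z|^(2k)` times the moment
`∫ |ζ₁|^(2k+1)`, a quotient of Gamma values.  Hence the bound is `n + 1` times an average of the
numbers `levelConst n α k` with the negative binomial weights `(1 - x)^α binomCoeff α k x^k`,
`x = |z|²` (`weighted_integral_le`).  The ratio of consecutive numbers shows that they increase up
to the index `kIndex n α` and decrease afterwards, strictly except possibly for one step from the
maximum.  As `x` ranges over a compact interval on which the mass of the two possible maximal
indices stays below one, the average stays below the maximum by a fixed amount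
(`exists_gradZbar_berezin_gap`).  This gives the strict inequality for `α > 2n + 3`, and for
`0 < α ≤ 2n + 3`, where `kIndex n α = 0`, it shows that the supremum can only be attained at the
origin.  For `α < 0` the scalar integral is bounded below while `(1 - |z|²)^α` is unbounded
(`le_opNormZbar_of_neg`).
-/

noncomputable section

namespace BerezinBloch

open MeasureTheory
open scoped ENNReal ComplexConjugate

/-! ### The automorphisms of the ball -/

section Automorphism

variable {E : Type*} [NormedAddCommGroup E] [InnerProductSpace ℂ E]

/-- The number `√(1 - |z|²)` attached to a point `z` of the unit ball. -/
def defect {F : Type*} [NormedAddCommGroup F] (z : F) : ℝ := Real.sqrt (1 - ‖z‖ ^ 2)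

/-- The operator `P + √(1 - |z|²) Q`, where `P` is the orthogonal projection onto `ℂ z` and
`Q = 1 - P`.  The formula used here does not divide by `|z|`, so that `z = 0` gives the identity. -/
def contraction (z : E) : E →L[ℂ] E :=
  (defect z : ℂ) • ContinuousLinearMap.id ℂ E +
    (innerSL ℂ z).smulRight (((1 + defect z : ℝ) : ℂ)⁻¹ • z)

/-- The involutive automorphism of the unit ball that exchanges `0` and `z`. -/
def mobius (z ζ : E) : E := (1 - inner ℂ z ζ)⁻¹ • (z - contraction z ζ)

lemma herm_eq_inner {n : ℕ} (z w : Cn n) : herm z w = inner ℂ w z := by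
  simp [herm, PiLp.inner_apply]

lemma contraction_apply (z ζ : E) :
    contraction z ζ = (defect z : ℂ) • ζ + (inner ℂ z ζ * ((1 + defect z : ℝ) : ℂ)⁻¹) • z := by
  simp [contraction, smul_smul]

lemma defect_nonneg {F : Type*} [NormedAddCommGroup F] (z : F) : 0 ≤ defect z := Real.sqrt_nonneg _

lemma defect_pos {F : Type*} [NormedAddCommGroup F] {z : F} (hz : ‖z‖ < 1) : 0 < defect z :=
  Real.sqrt_pos.2 (by nlinarith [norm_nonneg z])

lemma defect_sq {F : Type*} [NormedAddCommGroup F] {z : F} (hz : ‖z‖ < 1) :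
    defect z ^ 2 = 1 - ‖z‖ ^ 2 :=
  Real.sq_sqrt (by nlinarith [norm_nonneg z])

lemma one_sub_inner_ne_zero {z ζ : E} (hz : ‖z‖ < 1) (hζ : ‖ζ‖ ≤ 1) : 1 - inner ℂ z ζ ≠ 0 := by
  intro h
  have h1 : ‖(inner ℂ z ζ : ℂ)‖ ≤ ‖z‖ * ‖ζ‖ := norm_inner_le_norm z ζ
  rw [← sub_eq_zero.1 h] at h1
  simp only [norm_one] at h1
  nlinarith [norm_nonneg z, norm_nonneg ζ]

lemma inner_self_eq_one_sub_defect {z : E} (hz : ‖z‖ < 1) :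
    (inner ℂ z z : ℂ) = 1 - (defect z : ℂ) ^ 2 := by
  rw [inner_self_eq_norm_sq_to_K]
  have := defect_sq hz
  have h2 : ((‖z‖ : ℂ)) ^ 2 = 1 - (defect z : ℂ) ^ 2 := by
    rw [← Complex.ofReal_pow, ← Complex.ofReal_pow, this]; push_cast; ring
  exact h2

lemma one_add_defect_ne_zero {F : Type*} [NormedAddCommGroup F] (z : F) :
    ((1 + defect z : ℝ) : ℂ) ≠ 0 := by
  have := defect_nonneg z
  exact Complex.ofReal_ne_zero.2 (by positivity)

lemma contraction_self {z : E} (hz : ‖z‖ < 1) : contraction z z = z := by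
  have h := one_add_defect_ne_zero z
  rw [contraction_apply, ← add_smul, inner_self_eq_one_sub_defect hz]
  convert one_smul ℂ z
  field_simp
  push_cast
  ring

lemma inner_contraction_left (z x y : E) :
    inner ℂ (contraction z x) y = inner ℂ x (contraction z y) := by
  simp only [contraction_apply, inner_add_left, inner_add_right, inner_smul_left, inner_smul_right,
    map_mul, map_inv₀, Complex.conj_ofReal, inner_conj_symm]
  ring

lemma inner_contraction {z : E} (hz : ‖z‖ < 1) (ζ : E) :
    inner ℂ z (contraction z ζ) = inner ℂ z ζ := by
  rw [← inner_contraction_left, contraction_self hz]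

lemma contraction_contraction {z : E} (hz : ‖z‖ < 1) (ζ : E) :
    contraction z (contraction z ζ) = (defect z : ℂ) ^ 2 • ζ + inner ℂ z ζ • z := by
  have h := one_add_defect_ne_zero z
  rw [contraction_apply z (contraction z ζ), inner_contraction hz, contraction_apply]
  match_scalars
  · ring
  · push_cast at h ⊢
    field_simp
    ring

lemma norm_contraction_sq {z : E} (hz : ‖z‖ < 1) (ζ : E) :
    ‖contraction z ζ‖ ^ 2 = defect z ^ 2 * ‖ζ‖ ^ 2 + ‖inner ℂ z ζ‖ ^ 2 := by
  have h : (inner ℂ (contraction z ζ) (contraction z ζ) : ℂ) =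
      (defect z : ℂ) ^ 2 * inner ℂ ζ ζ + inner ℂ z ζ * conj (inner ℂ z ζ : ℂ) := by
    rw [inner_contraction_left, contraction_contraction hz, inner_add_right, inner_smul_right,
      inner_smul_right, inner_conj_symm]
  rw [inner_self_eq_norm_sq_to_K, inner_self_eq_norm_sq_to_K, Complex.mul_conj,
    Complex.normSq_eq_norm_sq] at h
  apply_fun Complex.re at h
  simp only [Complex.coe_algebraMap, ← Complex.ofReal_pow, ← Complex.ofReal_mul,
    ← Complex.ofReal_add, Complex.ofReal_re] at h
  exact h

lemma norm_contraction_le {z : E} (hz : ‖z‖ < 1) (ζ : E) : ‖contraction z ζ‖ ≤ ‖ζ‖ := by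
  have h1 := norm_contraction_sq hz ζ
  have h2 : ‖(inner ℂ z ζ : ℂ)‖ ^ 2 ≤ (‖z‖ * ‖ζ‖) ^ 2 :=
    pow_le_pow_left₀ (norm_nonneg _) (norm_inner_le_norm z ζ) 2
  have h3 := defect_sq hz
  refine (sq_le_sq₀ (norm_nonneg _) (norm_nonneg _)).1 ?_
  nlinarith [norm_nonneg ζ]

lemma one_sub_inner_mobius {z ζ : E} (hz : ‖z‖ < 1) (hζ : ‖ζ‖ < 1) :
    1 - inner ℂ z (mobius z ζ) = (defect z : ℂ) ^ 2 / (1 - inner ℂ z ζ) := by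
  have h := one_sub_inner_ne_zero hz hζ.le
  rw [mobius, inner_smul_right, inner_sub_right, inner_contraction hz,
    inner_self_eq_one_sub_defect hz]
  field_simp
  ring

lemma mobius_mobius {z ζ : E} (hz : ‖z‖ < 1) (hζ : ‖ζ‖ < 1) : mobius z (mobius z ζ) = ζ := by
  have h := one_sub_inner_ne_zero hz hζ.le
  have hs : (defect z : ℂ) ≠ 0 := Complex.ofReal_ne_zero.2 (defect_pos hz).ne'
  rw [mobius, one_sub_inner_mobius hz hζ, mobius, map_smul, map_sub, contraction_self hz,
    contraction_contraction hz]
  match_scalars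
  · field_simp
    ring
  · field_simp

lemma one_sub_norm_mobius_sq {z ζ : E} (hz : ‖z‖ < 1) (hζ : ‖ζ‖ < 1) :
    1 - ‖mobius z ζ‖ ^ 2 = defect z ^ 2 * (1 - ‖ζ‖ ^ 2) / ‖1 - inner ℂ z ζ‖ ^ 2 := by
  have h := norm_ne_zero_iff.2 (one_sub_inner_ne_zero hz hζ.le)
  have e1 : ‖z - contraction z ζ‖ ^ 2 =
      ‖z‖ ^ 2 - 2 * (inner ℂ z ζ).re + ‖contraction z ζ‖ ^ 2 := by
    rw [@norm_sub_sq ℂ, inner_contraction hz]; rfl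
  have e2 : ‖(1 : ℂ) - inner ℂ z ζ‖ ^ 2 =
      1 - 2 * (inner ℂ z ζ).re + ‖(inner ℂ z ζ : ℂ)‖ ^ 2 := by
    rw [← Complex.normSq_eq_norm_sq, ← Complex.normSq_eq_norm_sq, Complex.normSq_apply,
      Complex.normSq_apply]
    simp
    ring
  rw [mobius, norm_smul, norm_inv, mul_pow, inv_pow, e1, norm_contraction_sq hz]
  field_simp
  rw [e2, defect_sq hz]
  ring

lemma norm_mobius_lt_one {z ζ : E} (hz : ‖z‖ < 1) (hζ : ‖ζ‖ < 1) : ‖mobius z ζ‖ < 1 := by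
  have h := norm_pos_iff.2 (one_sub_inner_ne_zero hz hζ.le)
  have h1 := one_sub_norm_mobius_sq hz hζ
  have h2 : 0 < defect z ^ 2 * (1 - ‖ζ‖ ^ 2) / ‖1 - inner ℂ z ζ‖ ^ 2 := by
    have := defect_pos hz
    have : 0 < 1 - ‖ζ‖ ^ 2 := by nlinarith [norm_nonneg ζ]
    positivity
  nlinarith [norm_nonneg (mobius z ζ)]

/-- At `w = φ_z(ζ)` the logarithmic gradient of the Berezin kernel, times `1 - |z|²`,
is linear in `ζ`. -/
lemma smul_mobius_sub {z ζ : E} (hz : ‖z‖ < 1) (hζ : ‖ζ‖ < 1) :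
    ((defect z : ℂ) ^ 2 / (1 - inner ℂ z (mobius z ζ))) • mobius z ζ - z = -contraction z ζ := by
  have h := one_sub_inner_ne_zero hz hζ.le
  have hs : (defect z : ℂ) ≠ 0 := Complex.ofReal_ne_zero.2 (defect_pos hz).ne'
  rw [one_sub_inner_mobius hz hζ, mobius]
  match_scalars
  · field_simp
    ring
  · field_simp

lemma mobius_image_ball {z : E} (hz : ‖z‖ < 1) :
    mobius z '' Metric.ball 0 1 = Metric.ball 0 1 := by
  ext w
  simp only [Set.mem_image, mem_ball_zero_iff]
  constructor
  · rintro ⟨ζ, hζ, rfl⟩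
    exact norm_mobius_lt_one hz hζ
  · intro hw
    exact ⟨mobius z w, norm_mobius_lt_one hz hw, mobius_mobius hz hw⟩

lemma mobius_injOn_ball {z : E} (hz : ‖z‖ < 1) : Set.InjOn (mobius z) (Metric.ball 0 1) := by
  intro x hx y hy h
  rw [mem_ball_zero_iff] at hx hy
  rw [← mobius_mobius hz hx, h, mobius_mobius hz hy]

end Automorphism

/-! ### The Berezin kernel as a Jacobian -/

/-- The complex derivative of the ball automorphism `φ_z` at `ζ`. -/
def mobiusDeriv {E : Type*} [NormedAddCommGroup E] [InnerProductSpace ℂ E] (z ζ : E) : E →L[ℂ] E :=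
  -(1 - inner ℂ z ζ)⁻¹ • (contraction z - (innerSL ℂ z).smulRight (mobius z ζ))

lemma hasFDerivAt_mobius {E : Type*} [NormedAddCommGroup E] [InnerProductSpace ℂ E] {z ζ : E}
    (hD : 1 - inner ℂ z ζ ≠ 0) : HasFDerivAt (mobius z) (mobiusDeriv z ζ) ζ := by
  have h1 : HasFDerivAt (fun x : E => (1 - inner ℂ z x : ℂ)) (-innerSL ℂ z) ζ :=
    (innerSL ℂ z).hasFDerivAt.const_sub 1
  have h2 : HasFDerivAt (fun x : E => z - contraction z x) (-contraction z) ζ :=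
    (contraction z).hasFDerivAt.const_sub z
  have h3 := ((hasDerivAt_inv hD).comp_hasFDerivAt ζ h1).smul h2
  refine h3.congr_fderiv ?_
  ext h
  simp only [mobiusDeriv, mobius, add_apply, smul_apply,
    neg_apply, ContinuousLinearMap.smulRight_apply, innerSL_apply_apply,
    sub_apply, Function.comp_apply]
  match_scalars <;> simp <;> field_simp

/-- The derivative of `φ_z` is a multiple of a rank one perturbation of the identity. -/
lemma mobiusDeriv_eq_smul_transvection {E : Type*} [NormedAddCommGroup E] [InnerProductSpace ℂ E]
    {z : E} (hz : ‖z‖ < 1) (ζ : E) :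
    (mobiusDeriv z ζ : E →ₗ[ℂ] E) = (-(1 - inner ℂ z ζ)⁻¹ * (defect z : ℂ)) •
      LinearMap.transvection (innerSL ℂ z : E →ₗ[ℂ] ℂ)
        ((defect z : ℂ)⁻¹ • (((1 + defect z : ℝ) : ℂ)⁻¹ • z - mobius z ζ)) := by
  have hs : (defect z : ℂ) ≠ 0 := Complex.ofReal_ne_zero.2 (defect_pos hz).ne'
  ext h
  simp only [mobiusDeriv, contraction_apply, LinearMap.smul_apply, LinearMap.transvection.apply,
    ContinuousLinearMap.coe_coe, smul_apply, innerSL_apply_apply,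
    sub_apply, ContinuousLinearMap.smulRight_apply]
  match_scalars <;> field_simp

lemma det_mobiusDeriv {n : ℕ} {z ζ : Cn n} (hz : ‖z‖ < 1) (hζ : ‖ζ‖ < 1) :
    LinearMap.det (mobiusDeriv z ζ : Cn n →ₗ[ℂ] Cn n) =
      (-1) ^ n * ((defect z : ℂ) / (1 - inner ℂ z ζ)) ^ (n + 1) := by
  have hs : (defect z : ℂ) ≠ 0 := Complex.ofReal_ne_zero.2 (defect_pos hz).ne'
  have h1 := one_add_defect_ne_zero z
  have hD := one_sub_inner_ne_zero hz hζ.le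
  have h2 : (inner ℂ z (mobius z ζ) : ℂ) = 1 - (defect z : ℂ) ^ 2 / (1 - inner ℂ z ζ) := by
    rw [← one_sub_inner_mobius hz hζ]; ring
  have h3 : (1 : ℂ) + (innerSL ℂ z : Cn n →ₗ[ℂ] ℂ)
      ((defect z : ℂ)⁻¹ • (((1 + defect z : ℝ) : ℂ)⁻¹ • z - mobius z ζ)) =
        (defect z : ℂ) / (1 - inner ℂ z ζ) := by
    simp only [map_smul, map_sub, ContinuousLinearMap.coe_coe, innerSL_apply_apply, h2,
      inner_self_eq_one_sub_defect hz, smul_eq_mul]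
    push_cast at h1 ⊢
    field_simp
    ring
  rw [mobiusDeriv_eq_smul_transvection hz, LinearMap.det_smul, LinearMap.transvection.det, h3,
    finrank_euclideanSpace_fin, neg_mul, neg_pow, pow_succ, inv_mul_eq_div]
  ring

lemma kernel_eq_inner {n : ℕ} (z w : Cn n) :
    kernel z w = (1 - ‖z‖ ^ 2) ^ (n + 1) / ‖1 - inner ℂ z w‖ ^ (2 * n + 2) := by
  rw [kernel, herm_eq_inner, ← Complex.norm_conj]
  simp

/-- The Berezin kernel is the real Jacobian of the ball automorphism. -/
lemma abs_det_mobiusDeriv {n : ℕ} {z ζ : Cn n} (hz : ‖z‖ < 1) (hζ : ‖ζ‖ < 1) :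
    |((mobiusDeriv z ζ).restrictScalars ℝ).det| = kernel z ζ := by
  have h : ((mobiusDeriv z ζ).restrictScalars ℝ).det =
      Algebra.norm ℝ (LinearMap.det (mobiusDeriv z ζ : Cn n →ₗ[ℂ] Cn n)) :=
    LinearMap.det_restrictScalars
  rw [h, det_mobiusDeriv hz hζ, Algebra.norm_complex_apply, Complex.normSq_eq_norm_sq, norm_mul,
    norm_pow, norm_pow, norm_neg, norm_one, one_pow, one_mul, norm_div, Complex.norm_real,
    Real.norm_of_nonneg (defect_nonneg z), abs_of_nonneg (by positivity), kernel_eq_inner,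
    ← defect_sq hz, ← pow_mul, div_pow, ← pow_mul]
  congr 2 <;> ring

lemma measurableSet_unitBall (n : ℕ) : MeasurableSet (unitBall n) :=
  Metric.isOpen_ball.measurableSet

/-- Integration against the Berezin kernel is integration along the ball automorphism. -/
lemma integral_kernel_smul {n : ℕ} {F : Type*} [NormedAddCommGroup F] [NormedSpace ℝ F]
    {z : Cn n} (hz : ‖z‖ < 1) (g : Cn n → F) :
    ∫ w, kernel z w • g w ∂(ballVol n) = ∫ ζ, g (mobius z ζ) ∂(ballVol n) := by
  have h := integral_image_eq_integral_abs_det_fderiv_smul volume (measurableSet_unitBall n)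
    (f := mobius z) (f' := fun ζ => (mobiusDeriv z ζ).restrictScalars ℝ)
    (fun ζ hζ => ((hasFDerivAt_mobius (one_sub_inner_ne_zero hz
      (mem_ball_zero_iff.1 hζ).le)).restrictScalars ℝ).hasFDerivWithinAt)
    (mobius_injOn_ball hz) (fun ζ => g (mobius z ζ))
  rw [unitBall, mobius_image_ball hz] at h
  rw [ballVol, unitBall, h]
  refine setIntegral_congr_fun (measurableSet_unitBall n) fun ζ hζ => ?_
  have hζ' : ‖ζ‖ < 1 := mem_ball_zero_iff.1 hζ
  simp only [abs_det_mobiusDeriv hz hζ', mobius_mobius hz hζ']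

/-! ### Moments of the weighted measure -/

lemma integral_gaussian_moment_pi {n : ℕ} (i : Fin n) {p : ℝ} (hp : 0 ≤ p) :
    ∫ x : Fin n → ℂ, ‖x i‖ ^ p * Real.exp (-∑ j, ‖x j‖ ^ 2) =
      Real.pi ^ n * Real.Gamma (p / 2 + 1) := by
  have h1 : ∀ x : Fin n → ℂ, ‖x i‖ ^ p * Real.exp (-∑ j, ‖x j‖ ^ 2) =
      ∏ j, (if j = i then ‖x j‖ ^ p else 1) * Real.exp (-‖x j‖ ^ 2) := by
    intro x
    rw [Finset.prod_mul_distrib, ← Real.exp_sum, Finset.sum_neg_distrib]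
    simp
  have hg : ∀ q : ℝ, 0 ≤ q → ∫ x : ℂ, ‖x‖ ^ q * Real.exp (-‖x‖ ^ 2) =
      Real.pi * Real.Gamma (q / 2 + 1) := by
    intro q hq
    have := Complex.integral_rpow_mul_exp_neg_rpow (p := 2) (q := q) (by norm_num) (by linarith)
    simp only [Real.rpow_two] at this
    rw [this]
    congr 2 <;> ring
  simp_rw [h1]
  rw [integral_fintype_prod_volume_eq_prod (E := fun _ : Fin n => ℂ)
    (fun j (x : ℂ) => (if j = i then ‖x‖ ^ p else 1) * Real.exp (-‖x‖ ^ 2))]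
  have h2 : ∀ j : Fin n, ∫ x : ℂ, (if j = i then ‖x‖ ^ p else 1) * Real.exp (-‖x‖ ^ 2) =
      Real.pi * (if j = i then Real.Gamma (p / 2 + 1) else 1) := by
    intro j
    split_ifs
    · exact hg p hp
    · have := hg 0 le_rfl
      simpa using this
  simp_rw [h2]
  rw [Finset.prod_mul_distrib]
  simp

lemma measurePreserving_toLp {n : ℕ} (hn : 0 < n) :
    MeasurePreserving (WithLp.toLp 2 : (Fin n → ℂ) → Cn n) := by
  refine ⟨by fun_prop, ?_⟩
  set e := (PiLp.continuousLinearEquiv 2 ℝ (fun _ : Fin n => ℂ)).symm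
  set μ : Measure (Cn n) := Measure.map e (volume : Measure (Fin n → ℂ))
  have : μ.IsAddHaarMeasure := e.isAddHaarMeasure_map _
  have hμ := Measure.isAddLeftInvariant_eq_smul μ (volume : Measure (Cn n))
  set c := Measure.addHaarScalarFactor μ (volume : Measure (Cn n))
  have h1 : ∫ x, Real.exp (-‖x‖ ^ 2) ∂μ = Real.pi ^ n := by
    rw [integral_map e.continuous.aemeasurable (by fun_prop)]
    have := integral_gaussian_moment_pi (n := n) ⟨0, hn⟩ le_rfl
    simp only [Real.rpow_zero, one_mul, zero_div, zero_add, Real.Gamma_one, mul_one] at this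
    rw [← this]
    refine integral_congr_ae (ae_of_all _ fun x => ?_)
    simp only [EuclideanSpace.norm_sq_eq]
    rfl
  have h2 : ∫ x : Cn n, Real.exp (-‖x‖ ^ 2) = Real.pi ^ n := by
    have := GaussianFourier.integral_rexp_neg_mul_sq_norm (V := Cn n) (b := 1) one_pos
    rw [show Module.finrank ℝ (Cn n) = 2 * n by
      rw [finrank_real_of_complex, finrank_euclideanSpace_fin]] at this
    simpa using this
  rw [hμ, integral_smul_nnreal_measure, h2] at h1
  have hc : c = 1 := by
    have hpi : (Real.pi ^ n) ≠ 0 := by positivity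
    rw [NNReal.smul_def, smul_eq_mul] at h1
    exact_mod_cast (mul_eq_right₀ hpi).1 h1
  rw [hc, one_smul] at hμ
  exact hμ

lemma lintegral_gaussian_moment {n : ℕ} (i : Fin n) {p : ℝ} (hp : 0 ≤ p) :
    ∫⁻ x : Cn n, ENNReal.ofReal (‖x i‖ ^ p * Real.exp (-‖x‖ ^ 2)) =
      ENNReal.ofReal (Real.pi ^ n * Real.Gamma (p / 2 + 1)) := by
  have h : ∫ x : Cn n, ‖x i‖ ^ p * Real.exp (-‖x‖ ^ 2) =
      Real.pi ^ n * Real.Gamma (p / 2 + 1) := by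
    rw [← integral_gaussian_moment_pi i hp, ← (measurePreserving_toLp (Fin.pos i)).integral_comp
      (MeasurableEquiv.toLp 2 (Fin n → ℂ)).measurableEmbedding]
    simp only [EuclideanSpace.norm_sq_eq]
  rw [← h, ofReal_integral_eq_lintegral_ofReal]
  · refine .of_integral_ne_zero ?_
    have := Real.Gamma_pos_of_pos (by positivity : 0 < p / 2 + 1)
    rw [h]; positivity
  · exact ae_of_all _ fun x => by positivity

/-- The moment of order `p` of a coordinate, over the ball of squared radius `t`
and with the weight `(t - |x|²)^α`. -/
def ballMoment {n : ℕ} (i : Fin n) (α p t : ℝ) : ℝ≥0∞ :=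
  ∫⁻ x : Cn n, ENNReal.ofReal (‖x i‖ ^ p) *
    if ‖x‖ ^ 2 < t then ENNReal.ofReal ((t - ‖x‖ ^ 2) ^ α) else 0

lemma measurable_ballMoment_integrand {n : ℕ} (i : Fin n) (α p : ℝ) :
    Measurable fun q : ℝ × Cn n => ENNReal.ofReal (‖q.2 i‖ ^ p) *
      if ‖q.2‖ ^ 2 < q.1 then ENNReal.ofReal ((q.1 - ‖q.2‖ ^ 2) ^ α) else 0 := by
  refine Measurable.mul (by fun_prop) (Measurable.ite ?_ (by fun_prop) (by fun_prop))
  exact measurableSet_lt (by fun_prop) (by fun_prop)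

lemma measurable_ballMoment_slice {n : ℕ} (i : Fin n) (α p t : ℝ) :
    Measurable fun x : Cn n => ENNReal.ofReal (‖x i‖ ^ p) *
      if ‖x‖ ^ 2 < t then ENNReal.ofReal ((t - ‖x‖ ^ 2) ^ α) else 0 :=
  Measurable.mul (by fun_prop) (Measurable.ite (measurableSet_lt (by fun_prop) (by fun_prop))
    (by fun_prop) (by fun_prop))

lemma ballMoment_eq {n : ℕ} (i : Fin n) (α : ℝ) {p t : ℝ} (ht : 0 < t) :
    ballMoment i α p t = ENNReal.ofReal (t ^ (α + n + p / 2)) * ballMoment i α p 1 := by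
  set r := Real.sqrt t
  have hr : 0 < r := Real.sqrt_pos.2 ht
  have hr2 : r ^ 2 = t := Real.sq_sqrt ht.le
  have h2 : (volume : Measure (Cn n)) = ENNReal.ofReal (t ^ (n : ℝ)) •
      Measure.map (fun x => r • x) (volume : Measure (Cn n)) := by
    rw [Measure.map_addHaar_smul _ hr.ne', smul_smul, ← ENNReal.ofReal_mul (by positivity),
      finrank_real_of_complex, finrank_euclideanSpace_fin, abs_of_pos (by positivity), pow_mul,
      hr2, Real.rpow_natCast, mul_inv_cancel₀ (by positivity)]
    simp
  have hmeas := measurable_ballMoment_slice i α p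
  have hm : Measurable fun x : Cn n => ENNReal.ofReal (‖(r • x) i‖ ^ p) *
      if ‖r • x‖ ^ 2 < t then ENNReal.ofReal ((t - ‖r • x‖ ^ 2) ^ α) else 0 :=
    (hmeas t).comp (measurable_const_smul r)
  rw [ballMoment]
  nth_rewrite 1 [h2]
  rw [lintegral_smul_measure, lintegral_map (hmeas t) (by fun_prop), ballMoment,
    smul_eq_mul, ← lintegral_const_mul _ hm,
    ← lintegral_const_mul _ (hmeas 1)]
  congr 1
  ext x
  have hx : ‖r • x‖ ^ 2 = t * ‖x‖ ^ 2 := by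
    rw [norm_smul, mul_pow, Real.norm_of_nonneg hr.le, hr2]
  have hxi : ‖(r • x) i‖ ^ p = t ^ (p / 2) * ‖x i‖ ^ p := by
    rw [PiLp.smul_apply, norm_smul, Real.mul_rpow (norm_nonneg _) (norm_nonneg _),
      Real.norm_of_nonneg hr.le]
    congr 1
    rw [← hr2, ← Real.rpow_natCast, ← Real.rpow_mul hr.le]
    congr 1
    push_cast
    ring
  simp only [hx, hxi]
  by_cases h : ‖x‖ ^ 2 < 1
  · have h' : t * ‖x‖ ^ 2 < t := by nlinarith
    rw [if_pos h, if_pos h', show t - t * ‖x‖ ^ 2 = t * (1 - ‖x‖ ^ 2) by ring,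
      Real.mul_rpow ht.le (by linarith), ← ENNReal.ofReal_mul (by positivity),
      ← ENNReal.ofReal_mul (by positivity), ← ENNReal.ofReal_mul (by positivity),
      ← ENNReal.ofReal_mul (by positivity), Real.rpow_add ht, Real.rpow_add ht]
    congr 1
    ring
  · have h' : ¬ t * ‖x‖ ^ 2 < t := by nlinarith
    rw [if_neg h, if_neg h']
    simp

lemma ballMoment_of_nonpos {n : ℕ} (i : Fin n) (α p : ℝ) {t : ℝ} (ht : t ≤ 0) :
    ballMoment i α p t = 0 := by
  have : ∀ x : Cn n, ¬ ‖x‖ ^ 2 < t := fun x => by nlinarith [sq_nonneg ‖x‖]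
  simp [ballMoment, this]

lemma lintegral_exp_neg_mul_rpow {a : ℝ} (ha : -1 < a) :
    ∫⁻ t in Set.Ioi (0 : ℝ), ENNReal.ofReal (Real.exp (-t) * t ^ a) =
      ENNReal.ofReal (Real.Gamma (a + 1)) := by
  have h := Real.GammaIntegral_convergent (s := a + 1) (by linarith)
  rw [Real.Gamma_eq_integral (by linarith), ofReal_integral_eq_lintegral_ofReal h]
  · simp
  · refine (ae_restrict_iff' measurableSet_Ioi).2 (ae_of_all _ fun t ht => ?_)
    have : 0 < t := ht
    positivity

/-- The Laplace transform in the squared radius turns moments over balls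
into Gaussian moments. -/
lemma lintegral_exp_neg_mul_ballMoment {n : ℕ} (i : Fin n) {α p : ℝ} (hα : -1 < α) (hp : 0 ≤ p) :
    ∫⁻ t : ℝ, ENNReal.ofReal (Real.exp (-t)) * ballMoment i α p t =
      ENNReal.ofReal (Real.pi ^ n * Real.Gamma (p / 2 + 1)) *
        ENNReal.ofReal (Real.Gamma (α + 1)) := by
  have hm := measurable_ballMoment_integrand i α p
  have h1 : ∀ t : ℝ, ENNReal.ofReal (Real.exp (-t)) * ballMoment i α p t =
      ∫⁻ x : Cn n, ENNReal.ofReal (Real.exp (-t)) * (ENNReal.ofReal (‖x i‖ ^ p) *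
        if ‖x‖ ^ 2 < t then ENNReal.ofReal ((t - ‖x‖ ^ 2) ^ α) else 0) := fun t => by
    rw [ballMoment, lintegral_const_mul _ (measurable_ballMoment_slice i α p t)]
  simp_rw [h1]
  rw [lintegral_lintegral_swap]
  · rw [← lintegral_gaussian_moment i hp, ← lintegral_mul_const _ (by fun_prop)]
    congr 1
    ext x
    rw [← lintegral_add_right_eq_self _ (‖x‖ ^ 2), ← lintegral_exp_neg_mul_rpow hα,
      ← lintegral_const_mul _ (by fun_prop), ← lintegral_indicator measurableSet_Ioi]
    congr 1
    ext t
    rw [Set.indicator_apply]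
    by_cases ht : 0 < t
    · rw [if_pos (show t ∈ Set.Ioi (0 : ℝ) from ht), if_pos (by linarith), add_sub_cancel_right,
        ← ENNReal.ofReal_mul (by positivity), ← ENNReal.ofReal_mul (by positivity),
        ← ENNReal.ofReal_mul (by positivity), neg_add, Real.exp_add]
      congr 1
      ring
    · rw [if_neg (show t ∉ Set.Ioi (0 : ℝ) from ht), if_neg (by linarith)]
      simp
  · exact (Measurable.mul (by fun_prop) hm).aemeasurable

lemma ballMoment_one {n : ℕ} (i : Fin n) {α p : ℝ} (hα : -1 < α) (hp : 0 ≤ p) :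
    ballMoment i α p 1 = ENNReal.ofReal (Real.pi ^ n * Real.Gamma (α + 1) *
      Real.Gamma (p / 2 + 1) / Real.Gamma (α + n + p / 2 + 1)) := by
  have h := lintegral_exp_neg_mul_ballMoment i hα hp
  have hn : (0 : ℝ) ≤ n := Nat.cast_nonneg n
  have hG' : 0 < Real.Gamma (p / 2 + 1) := Real.Gamma_pos_of_pos (by linarith)
  have hG : 0 < Real.Gamma (α + n + p / 2 + 1) := Real.Gamma_pos_of_pos (by linarith)
  have h1 : ∀ t : ℝ, ENNReal.ofReal (Real.exp (-t)) * ballMoment i α p t =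
      (Set.Ioi (0 : ℝ)).indicator
        (fun t => ENNReal.ofReal (Real.exp (-t) * t ^ (α + n + p / 2))) t *
        ballMoment i α p 1 := by
    intro t
    rw [Set.indicator_apply]
    by_cases ht : 0 < t
    · rw [if_pos (show t ∈ Set.Ioi (0 : ℝ) from ht), ballMoment_eq i α ht,
        ENNReal.ofReal_mul (by positivity), mul_assoc]
    · rw [if_neg (show t ∉ Set.Ioi (0 : ℝ) from ht), ballMoment_of_nonpos i α p (by linarith)]
      simp
  simp_rw [h1] at h
  rw [lintegral_mul_const _ (Measurable.indicator (by fun_prop) measurableSet_Ioi),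
    lintegral_indicator measurableSet_Ioi, lintegral_exp_neg_mul_rpow (by linarith),
    ← ENNReal.ofReal_mul (by positivity)] at h
  rw [ENNReal.ofReal_div_of_pos hG, ENNReal.eq_div_iff (by simpa using hG) (by simp), h]
  congr 1
  ring

/-- The measure `(1 - |w|²)^α dv(w)` on the unit ball. -/
def weighted (n : ℕ) (α : ℝ) : Measure (Cn n) :=
  (ballVol n).withDensity fun w => ENNReal.ofReal ((1 - ‖w‖ ^ 2) ^ α)

lemma measurable_weight (n : ℕ) (α : ℝ) :
    Measurable fun w : Cn n => ENNReal.ofReal ((1 - ‖w‖ ^ 2) ^ α) := by fun_prop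

lemma ae_ballVol_norm_lt (n : ℕ) : ∀ᵐ w ∂(ballVol n), ‖w‖ < 1 := by
  filter_upwards [ae_restrict_mem (measurableSet_unitBall n)] with w hw
  exact mem_ball_zero_iff.1 hw

lemma weight_pos {n : ℕ} (α : ℝ) {w : Cn n} (hw : ‖w‖ < 1) : 0 < (1 - ‖w‖ ^ 2) ^ α :=
  Real.rpow_pos_of_pos (by nlinarith [norm_nonneg w]) _

lemma weighted_absolutelyContinuous (n : ℕ) (α : ℝ) : weighted n α ≪ ballVol n :=
  withDensity_absolutelyContinuous _ _

lemma ballVol_absolutelyContinuous (n : ℕ) (α : ℝ) : ballVol n ≪ weighted n α := by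
  refine withDensity_absolutelyContinuous' (measurable_weight n α).aemeasurable ?_
  filter_upwards [ae_ballVol_norm_lt n] with w hw
  simpa using weight_pos α hw

lemma ae_weighted_norm_lt (n : ℕ) (α : ℝ) : ∀ᵐ w ∂(weighted n α), ‖w‖ < 1 :=
  (weighted_absolutelyContinuous n α).ae_le (ae_ballVol_norm_lt n)

lemma lintegral_weighted {n : ℕ} (α : ℝ) {g : Cn n → ℝ≥0∞} (hg : Measurable g) :
    ∫⁻ w, g w ∂(weighted n α) =
      ∫⁻ w, g w * (if ‖w‖ ^ 2 < 1 then ENNReal.ofReal ((1 - ‖w‖ ^ 2) ^ α) else 0) := by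
  rw [weighted, lintegral_withDensity_eq_lintegral_mul _ (measurable_weight n α) hg, ballVol,
    ← lintegral_indicator (measurableSet_unitBall n)]
  congr 1
  ext w
  have h : w ∈ unitBall n ↔ ‖w‖ ^ 2 < 1 := by
    rw [unitBall, mem_ball_zero_iff, sq_lt_one_iff₀ (norm_nonneg _)]
  by_cases hw : ‖w‖ ^ 2 < 1
  · rw [Set.indicator_of_mem (h.2 hw), if_pos hw, Pi.mul_apply, mul_comm]
  · rw [Set.indicator_of_notMem (mt h.1 hw), if_neg hw, mul_zero]

lemma integral_weighted {n : ℕ} {F : Type*} [NormedAddCommGroup F] [NormedSpace ℝ F]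
    (α : ℝ) (g : Cn n → F) :
    ∫ w, g w ∂(weighted n α) = ∫ w, (1 - ‖w‖ ^ 2) ^ α • g w ∂(ballVol n) := by
  rw [weighted, integral_withDensity_eq_integral_toReal_smul (measurable_weight n α)
    (ae_of_all _ fun _ => ENNReal.ofReal_lt_top)]
  refine integral_congr_ae ?_
  filter_upwards [ae_ballVol_norm_lt n] with w hw
  rw [ENNReal.toReal_ofReal (weight_pos α hw).le]

lemma measurePreserving_weighted {n : ℕ} (α : ℝ) (U : Cn n ≃ₗᵢ[ℂ] Cn n) :
    MeasurePreserving U (weighted n α) (weighted n α) := by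
  have hU : Measurable U := U.continuous.measurable
  have hv : MeasurePreserving U (volume : Measure (Cn n)) volume :=
    LinearIsometryEquiv.measurePreserving
      (⟨U.toLinearEquiv.restrictScalars ℝ, U.norm_map⟩ : Cn n ≃ₗᵢ[ℝ] Cn n)
  refine ⟨hU, Measure.ext_of_lintegral _ fun g hg => ?_⟩
  have hk : Measurable fun w : Cn n =>
      g w * (if ‖w‖ ^ 2 < 1 then ENNReal.ofReal ((1 - ‖w‖ ^ 2) ^ α) else 0) :=
    hg.mul (Measurable.ite (measurableSet_lt (by fun_prop) (by fun_prop)) (by fun_prop)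
      (by fun_prop))
  rw [lintegral_map hg hU, lintegral_weighted α (g := fun w => g (U w)) (hg.comp hU),
    lintegral_weighted α hg,    ← hv.lintegral_comp hk]
  simp

/-- The value of the moment `∫ |⟨ζ, e⟩|^p (1 - |ζ|²)^α dv(ζ)`, `e` a unit vector, in closed form. -/
def moment (n : ℕ) (α p : ℝ) : ℝ :=
  Real.pi ^ n * Real.Gamma (α + 1) * Real.Gamma (p / 2 + 1) / Real.Gamma (α + n + p / 2 + 1)

lemma moment_pos (n : ℕ) {α p : ℝ} (hα : -1 < α) (hp : 0 ≤ p) : 0 < moment n α p := by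
  have hn : (0 : ℝ) ≤ n := Nat.cast_nonneg n
  have h1 := Real.Gamma_pos_of_pos (show 0 < α + 1 by linarith)
  have h2 := Real.Gamma_pos_of_pos (show 0 < p / 2 + 1 by linarith)
  have h3 := Real.Gamma_pos_of_pos (show 0 < α + n + p / 2 + 1 by linarith)
  rw [moment]
  positivity

lemma lintegral_weighted_coord {n : ℕ} (i : Fin n) {α p : ℝ} (hα : -1 < α) (hp : 0 ≤ p) :
    ∫⁻ ζ, ENNReal.ofReal (‖ζ i‖ ^ p) ∂(weighted n α) = ENNReal.ofReal (moment n α p) := by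
  rw [lintegral_weighted α (by fun_prop), moment, ← ballMoment_one i hα hp, ballMoment]

lemma isFiniteMeasure_weighted {n : ℕ} (hn : 0 < n) {α : ℝ} (hα : -1 < α) :
    IsFiniteMeasure (weighted n α) := by
  have h := lintegral_weighted_coord (⟨0, hn⟩ : Fin n) hα le_rfl
  refine ⟨?_⟩
  simp only [Real.rpow_zero, ENNReal.ofReal_one, lintegral_one] at h
  rw [h]
  exact ENNReal.ofReal_lt_top

/-- The unitary group acts transitively on unit vectors. -/
lemma exists_unitary_coord {n : ℕ} (i : Fin n) {e : Cn n} (he : ‖e‖ = 1) :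
    ∃ U : Cn n ≃ₗᵢ[ℂ] Cn n, ∀ ζ, U ζ i = inner ℂ e ζ := by
  have ho : Orthonormal ℂ (({i} : Set (Fin n)).domRestrict fun _ => e) := by
    refine ⟨fun _ => he, fun a b hab => (hab (Subsingleton.elim _ _)).elim⟩
  obtain ⟨b, hb⟩ := ho.exists_orthonormalBasis_extension_of_card_eq (by simp)
  refine ⟨b.repr, fun ζ => ?_⟩
  rw [b.repr_apply_apply, hb i rfl]

lemma integral_weighted_inner_rpow {n : ℕ} (hn : 0 < n) {α p : ℝ} (hα : -1 < α) (hp : 0 ≤ p)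
    {e : Cn n} (he : ‖e‖ = 1) :
    ∫ ζ, ‖(inner ℂ e ζ : ℂ)‖ ^ p ∂(weighted n α) = moment n α p := by
  obtain ⟨U, hU⟩ := exists_unitary_coord ⟨0, hn⟩ he
  have h1 := (measurePreserving_weighted α U).integral_comp
    U.toHomeomorph.measurableEmbedding (fun ζ => ‖ζ ⟨0, hn⟩‖ ^ p)
  simp only [hU] at h1
  rw [h1, integral_eq_lintegral_of_nonneg_ae (ae_of_all _ fun x => by positivity)
    (Measurable.aestronglyMeasurable (by fun_prop)), lintegral_weighted_coord _ hα hp,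
    ENNReal.toReal_ofReal (moment_pos n hα hp).le]

/-! ### Power series expansion of the scalar integral -/

/-- The coefficient of `x ^ k` in the expansion of `(1 - x) ^ (-α)`. -/
def binomCoeff (α : ℝ) (k : ℕ) : ℝ := Ring.choose (α + k - 1) k

lemma binomCoeff_zero (α : ℝ) : binomCoeff α 0 = 1 := by simp [binomCoeff]

lemma factorial_mul_binomCoeff (α : ℝ) (k : ℕ) :
    (k.factorial : ℝ) * binomCoeff α k = (ascPochhammer ℝ k).eval α := by
  rw [binomCoeff, ← Ring.multichoose_eq, ← nsmul_eq_mul,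
    Ring.factorial_nsmul_multichoose_eq_ascPochhammer,
    Polynomial.ascPochhammer_smeval_eq_eval]

lemma succ_mul_binomCoeff_succ (α : ℝ) (k : ℕ) :
    ((k : ℝ) + 1) * binomCoeff α (k + 1) = (α + k) * binomCoeff α k := by
  have h1 := factorial_mul_binomCoeff α (k + 1)
  have h2 := factorial_mul_binomCoeff α k
  rw [ascPochhammer_succ_eval, ← h2, Nat.factorial_succ] at h1
  push_cast at h1
  have h3 : (k.factorial : ℝ) ≠ 0 := by positivity
  apply mul_left_cancel₀ h3
  linarith

lemma binomCoeff_nonneg {α : ℝ} (hα : 0 ≤ α) (k : ℕ) : 0 ≤ binomCoeff α k := by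
  induction k with
  | zero => simp [binomCoeff_zero]
  | succ k ih =>
    have h := succ_mul_binomCoeff_succ α k
    have : 0 ≤ ((k : ℝ) + 1) * binomCoeff α (k + 1) := h ▸ by positivity
    exact nonneg_of_mul_nonneg_right this (by positivity)

lemma binomCoeff_pos {α : ℝ} (hα : 0 < α) (k : ℕ) : 0 < binomCoeff α k := by
  induction k with
  | zero => simp [binomCoeff_zero]
  | succ k ih =>
    have h := succ_mul_binomCoeff_succ α k
    have : 0 < ((k : ℝ) + 1) * binomCoeff α (k + 1) := h ▸ by positivity
    exact pos_of_mul_pos_right this (by positivity)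

lemma hasSum_binomCoeff_rpow (α : ℝ) {x : ℝ} (hx0 : 0 ≤ x) (hx : x < 1) :
    HasSum (fun k => binomCoeff α k * x ^ k) ((1 - x) ^ (-α)) := by
  have h := (Real.one_div_one_sub_rpow_hasFPowerSeriesOnBall_zero α).hasSum (y := x) (by
    rw [Metric.mem_eball, edist_zero_right]
    simpa [enorm_eq_nnnorm, ← NNReal.coe_lt_coe, abs_of_nonneg hx0] using hx)
  simp only [FormalMultilinearSeries.ofScalars_apply_eq, smul_eq_mul, zero_add] at h
  rw [Real.rpow_neg (by linarith), ← one_div]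
  simpa [binomCoeff] using h

lemma hasSum_binomCoeff_cpow (α : ℝ) {x : ℂ} (hx : ‖x‖ < 1) :
    HasSum (fun k => (binomCoeff α k : ℂ) * x ^ k) ((1 - x) ^ (-α : ℂ)) := by
  have h := (Complex.one_div_one_sub_cpow_hasFPowerSeriesOnBall_zero α).hasSum (y := x) (by
    rw [Metric.mem_eball, edist_zero_right]
    simpa [enorm_eq_nnnorm, ← NNReal.coe_lt_coe] using hx)
  simp only [FormalMultilinearSeries.ofScalars_apply_eq, smul_eq_mul, zero_add] at h
  rw [Complex.cpow_neg, ← one_div]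
  have e : ∀ k : ℕ, (binomCoeff α k : ℂ) = Ring.choose ((α : ℂ) + k - 1) k := fun k => by
    rw [binomCoeff, Complex.ofReal_choose]; push_cast; rfl
  simpa [e] using h

lemma norm_one_sub_rpow (α : ℝ) {x : ℂ} (hx : ‖x‖ < 1) :
    ((‖1 - x‖ ^ (-(2 * α)) : ℝ) : ℂ) = (1 - x) ^ (-α : ℂ) * conj ((1 - x) ^ (-α : ℂ)) := by
  have hne : 1 - x ≠ 0 := by
    intro h
    rw [← sub_eq_zero.1 h] at hx
    simp at hx
  have h0 : 0 < ‖1 - x‖ := norm_pos_iff.2 hne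
  rw [Complex.mul_conj, Complex.normSq_eq_norm_sq, ← Complex.ofReal_neg,
    Complex.norm_cpow_real, ← Real.rpow_natCast, ← Real.rpow_mul h0.le]
  congr 2
  push_cast
  ring

lemma hasSum_mul_of_summable_norm {f g : ℕ → ℂ} {a b : ℂ} (hf : HasSum f a) (hg : HasSum g b)
    (hf' : Summable fun k => ‖f k‖) (hg' : Summable fun k => ‖g k‖) :
    HasSum (fun q : ℕ × ℕ => f q.1 * g q.2) (a * b) := by
  have h := (summable_mul_of_summable_norm hf' hg').hasSum
  rwa [← tsum_mul_tsum_of_summable_norm hf' hg', hf.tsum_eq, hg.tsum_eq] at h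

lemma hasSum_norm_one_sub_rpow {α : ℝ} (hα : 0 ≤ α) {x : ℂ} (hx : ‖x‖ < 1) :
    HasSum (fun q : ℕ × ℕ => (binomCoeff α q.1 * binomCoeff α q.2 : ℂ) * (x ^ q.1 * conj x ^ q.2))
      ((‖1 - x‖ ^ (-(2 * α)) : ℝ) : ℂ) := by
  have h1 := hasSum_binomCoeff_cpow α hx
  rw [norm_one_sub_rpow α hx]
  generalize (1 - x) ^ (-α : ℂ) = y at h1 ⊢
  have h2 : HasSum (fun k => (binomCoeff α k : ℂ) * conj x ^ k) (conj y) := by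
    have h := (Complex.hasSum_conj (f := fun k => (binomCoeff α k : ℂ) * x ^ k)
      (x := conj y)).2 (by rwa [Complex.conj_conj])
    simpa only [map_mul, map_pow, Complex.conj_ofReal] using h
  have hs := (hasSum_binomCoeff_rpow α (norm_nonneg x) hx).summable
  have h3 : Summable fun k => ‖(binomCoeff α k : ℂ) * x ^ k‖ := by
    refine hs.congr fun k => ?_
    rw [norm_mul, norm_pow, Complex.norm_real, Real.norm_of_nonneg (binomCoeff_nonneg hα k)]
  have h4 : Summable fun k => ‖(binomCoeff α k : ℂ) * conj x ^ k‖ := by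
    refine h3.congr fun k => ?_
    rw [norm_mul, norm_mul, norm_pow, norm_pow, RCLike.norm_conj]
  have h5 : HasSum (fun q : ℕ × ℕ => ((binomCoeff α q.1 : ℂ) * x ^ q.1) *
      ((binomCoeff α q.2 : ℂ) * conj x ^ q.2)) (y * conj y) :=
    hasSum_mul_of_summable_norm (f := fun k => (binomCoeff α k : ℂ) * x ^ k)
      (g := fun k => (binomCoeff α k : ℂ) * conj x ^ k) h1 h2 h3 h4
  refine (congrArg (HasSum · (y * conj y)) (funext fun q => ?_)).mp h5
  ring

lemma succ_mul_mul_pow_le {a b : ℝ} (ha : 0 ≤ a) (hb : 0 ≤ b) (m : ℕ) :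
    ((m : ℝ) + 1) * (a * b ^ m) ≤ a ^ (m + 1) + m * b ^ (m + 1) := by
  induction m with
  | zero => simp
  | succ m ih =>
    have h1 : 0 ≤ (a ^ (m + 1) - b ^ (m + 1)) * (a - b) := by
      rcases le_total a b with h | h
      · have := pow_le_pow_left₀ ha h (m + 1)
        exact mul_nonneg_of_nonpos_of_nonpos (by linarith) (by linarith)
      · have := pow_le_pow_left₀ hb h (m + 1)
        exact mul_nonneg (by linarith) (by linarith)
    have h2 := mul_le_mul_of_nonneg_left ih hb
    push_cast
    simp only [pow_succ] at *
    nlinarith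


lemma integrable_weighted_of_continuous {n : ℕ} {α : ℝ} (hn : 0 < n) (hα : -1 < α) {g : Cn n → ℝ}
    (hg : Continuous g) : Integrable g (weighted n α) := by
  have := isFiniteMeasure_weighted hn hα
  obtain ⟨C, hC⟩ := (isCompact_closedBall (0 : Cn n) 1).exists_bound_of_continuousOn hg.continuousOn
  refine Integrable.of_bound hg.measurable.aestronglyMeasurable C ?_
  filter_upwards [ae_weighted_norm_lt n α] with w hw
  exact hC w (mem_closedBall_zero_iff.2 hw.le)

/-- Among all unit vectors `e`, `e'` the mixed moment is largest for `e = e'`. -/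
lemma integral_mixed_moment_le {n : ℕ} (hn : 0 < n) {α : ℝ} (hα : -1 < α) {e e' : Cn n}
    (he : ‖e‖ = 1) (he' : ‖e'‖ = 1) (k : ℕ) :
    ∫ ζ, ‖(inner ℂ e ζ : ℂ)‖ * ‖(inner ℂ e' ζ : ℂ)‖ ^ (2 * k) ∂(weighted n α) ≤
      moment n α (2 * k + 1) := by
  have h1 : ∀ {e : Cn n}, ‖e‖ = 1 → ∫ ζ, ‖(inner ℂ e ζ : ℂ)‖ ^ (2 * k + 1) ∂(weighted n α) =
      moment n α (2 * k + 1) := fun {e} he => by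
    rw [← integral_weighted_inner_rpow hn hα (by positivity) he]
    simp_rw [← Real.rpow_natCast]
    push_cast
    rfl
  have hi : ∀ {e : Cn n}, Integrable (fun ζ => ‖(inner ℂ e ζ : ℂ)‖ ^ (2 * k + 1)) (weighted n α) :=
    integrable_weighted_of_continuous hn hα (by fun_prop)
  have h2 : ∫ ζ, (((2 * k : ℕ) : ℝ) + 1) *
      (‖(inner ℂ e ζ : ℂ)‖ * ‖(inner ℂ e' ζ : ℂ)‖ ^ (2 * k)) ∂(weighted n α) ≤
      ∫ ζ, (‖(inner ℂ e ζ : ℂ)‖ ^ (2 * k + 1) +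
        ((2 * k : ℕ) : ℝ) * ‖(inner ℂ e' ζ : ℂ)‖ ^ (2 * k + 1)) ∂(weighted n α) :=
    integral_mono (integrable_weighted_of_continuous hn hα (by fun_prop))
      (integrable_weighted_of_continuous hn hα (by fun_prop))
      fun ζ => succ_mul_mul_pow_le (norm_nonneg _) (norm_nonneg _) _
  rw [integral_const_mul, integral_add hi (hi.const_mul _), integral_const_mul, h1 he,
    h1 he'] at h2
  have h3 : (0 : ℝ) < ((2 * k : ℕ) : ℝ) + 1 := by positivity
  nlinarith

lemma exists_unit_smul {n : ℕ} (hn : 0 < n) (v : Cn n) :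
    ∃ e : Cn n, ‖e‖ = 1 ∧ v = (‖v‖ : ℂ) • e := by
  by_cases hv : v = 0
  · exact ⟨EuclideanSpace.single ⟨0, hn⟩ 1, by simp, by simp [hv]⟩
  · have hv' : (‖v‖ : ℂ) ≠ 0 := by simpa using hv
    exact ⟨(‖v‖ : ℂ)⁻¹ • v, by simp [norm_smul, hv],
      by rw [smul_smul, mul_inv_cancel₀ hv', one_smul]⟩

lemma integral_mixed_moment_le_mul {n : ℕ} (hn : 0 < n) {α : ℝ} (hα : -1 < α) (v z : Cn n)
    (k : ℕ) :
    ∫ ζ, ‖(inner ℂ v ζ : ℂ)‖ * ‖(inner ℂ z ζ : ℂ)‖ ^ (2 * k) ∂(weighted n α) ≤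
      ‖v‖ * (‖z‖ ^ 2) ^ k * moment n α (2 * k + 1) := by
  obtain ⟨e, he, hv⟩ := exists_unit_smul hn v
  obtain ⟨e', he', hz⟩ := exists_unit_smul hn z
  have h : ∀ ζ : Cn n, ‖(inner ℂ v ζ : ℂ)‖ * ‖(inner ℂ z ζ : ℂ)‖ ^ (2 * k) =
      (‖v‖ * (‖z‖ ^ 2) ^ k) * (‖(inner ℂ e ζ : ℂ)‖ * ‖(inner ℂ e' ζ : ℂ)‖ ^ (2 * k)) := fun ζ => by
    conv_lhs => rw [hv, hz]
    simp only [inner_smul_left, norm_mul, Complex.conj_ofReal, Complex.norm_real, norm_norm]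
    ring
  simp_rw [h]
  rw [integral_const_mul]
  exact mul_le_mul_of_nonneg_left (integral_mixed_moment_le hn hα he he' k) (by positivity)

/-- Terms of different bidegree integrate to zero against a circle invariant weight. -/
lemma integral_mul_pow_mul_conj_pow_eq_zero {n : ℕ} (α : ℝ) (v z : Cn n) {j k : ℕ} (hjk : j ≠ k) :
    ∫ ζ, ((‖(inner ℂ v ζ : ℂ)‖ : ℂ) * (inner ℂ z ζ ^ j * conj (inner ℂ z ζ) ^ k))
      ∂(weighted n α) = 0 := by
  set θ : ℝ := Real.pi / ((j : ℝ) - k)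
  have hd : (j : ℝ) - k ≠ 0 := sub_ne_zero.2 (by exact_mod_cast hjk)
  -- rotation by `θ` multiplies the integrand by `exp (i (j - k) θ) = -1`
  set c : Circle := Circle.exp θ
  have hc : (c : ℂ) ^ j * conj (c : ℂ) ^ k = -1 := by
    rw [← Circle.coe_inv_eq_conj, Circle.coe_inv, Circle.coe_exp, ← Complex.exp_neg,
      ← Complex.exp_nat_mul, ← Complex.exp_nat_mul, ← Complex.exp_add, ← Complex.exp_pi_mul_I]
    congr 1
    have hd' : (j : ℂ) - k ≠ 0 := by exact_mod_cast hd
    simp only [θ]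
    push_cast
    field_simp
    ring
  let U : Cn n ≃ₗᵢ[ℂ] Cn n := 
    { LinearEquiv.smulOfUnit (R := ℂ) (M := Cn n) (Circle.toUnits c) with
      norm_map' := fun ζ => by
        change ‖(c : ℂ) • ζ‖ = ‖ζ‖
        rw [norm_smul, Circle.norm_coe, one_mul] }
  have h := (measurePreserving_weighted α U).integral_comp U.toHomeomorph.measurableEmbedding
    (fun ζ => ((‖(inner ℂ v ζ : ℂ)‖ : ℂ) * (inner ℂ z ζ ^ j * conj (inner ℂ z ζ) ^ k)))
  have h2 : ∀ ζ : Cn n, (‖(inner ℂ v (U ζ) : ℂ)‖ : ℂ) *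
      (inner ℂ z (U ζ) ^ j * conj (inner ℂ z (U ζ)) ^ k) =
      -((‖(inner ℂ v ζ : ℂ)‖ : ℂ) * (inner ℂ z ζ ^ j * conj (inner ℂ z ζ) ^ k)) := by
    intro ζ
    have hU : U ζ = (c : ℂ) • ζ := rfl
    rw [hU, inner_smul_right, inner_smul_right, norm_mul, Circle.norm_coe, one_mul, mul_pow,
      map_mul, mul_pow]
    linear_combination ((‖(inner ℂ v ζ : ℂ)‖ : ℂ) * (inner ℂ z ζ ^ j * conj (inner ℂ z ζ) ^ k)) * hc
  simp_rw [h2, integral_neg] at h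
  exact self_eq_neg.1 h.symm

/-- The expansion of `∫ |⟨ζ, v⟩| |1 - ⟨ζ, z⟩|^(-2α) (1 - |ζ|²)^α dv(ζ)`. -/
lemma hasSum_integral_expansion {n : ℕ} (hn : 0 < n) {α : ℝ} (hα : 0 ≤ α) (v : Cn n) {z : Cn n}
    (hz : ‖z‖ < 1) :
    HasSum (fun k => binomCoeff α k ^ 2 *
      ∫ ζ, ‖(inner ℂ v ζ : ℂ)‖ * ‖(inner ℂ z ζ : ℂ)‖ ^ (2 * k) ∂(weighted n α))
      (∫ ζ, ‖(inner ℂ v ζ : ℂ)‖ * ‖1 - inner ℂ z ζ‖ ^ (-(2 * α)) ∂(weighted n α)) := by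
  have hfin := isFiniteMeasure_weighted hn (α := α) (by linarith)
  let F : ℕ × ℕ → Cn n → ℂ := fun q ζ => (binomCoeff α q.1 * binomCoeff α q.2 : ℂ) *
    ((‖(inner ℂ v ζ : ℂ)‖ : ℂ) * (inner ℂ z ζ ^ q.1 * conj (inner ℂ z ζ) ^ q.2))
  have hb := binomCoeff_nonneg hα
  have hFn : ∀ q, ∀ ζ : Cn n, ‖ζ‖ < 1 → ‖F q ζ‖ ≤
      ‖v‖ * ((binomCoeff α q.1 * ‖z‖ ^ q.1) * (binomCoeff α q.2 * ‖z‖ ^ q.2)) := by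
    intro q ζ hζ
    have h1 : ‖(inner ℂ v ζ : ℂ)‖ ≤ ‖v‖ := (norm_inner_le_norm v ζ).trans
      (mul_le_of_le_one_right (norm_nonneg _) hζ.le)
    have h2 : ‖(inner ℂ z ζ : ℂ)‖ ≤ ‖z‖ := (norm_inner_le_norm z ζ).trans
      (mul_le_of_le_one_right (norm_nonneg _) hζ.le)
    simp only [F, norm_mul, norm_pow, RCLike.norm_conj, Complex.norm_real, norm_norm,
      Real.norm_of_nonneg (hb _)]
    have h3 := hb q.1
    have h4 := hb q.2
    calc _ ≤ binomCoeff α q.1 * binomCoeff α q.2 * (‖v‖ * (‖z‖ ^ q.1 * ‖z‖ ^ q.2)) := by gcongr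
      _ = _ := by ring
  have hFc : ∀ q, Continuous (F q) := fun q => by
    have : Continuous fun ζ : Cn n => conj (inner ℂ z ζ) :=
      Complex.continuous_conj.comp (by fun_prop)
    fun_prop
  have hFi : ∀ q, Integrable (F q) (weighted n α) := fun q => by
    refine Integrable.of_bound (hFc q).measurable.aestronglyMeasurable
      (‖v‖ * ((binomCoeff α q.1 * ‖z‖ ^ q.1) * (binomCoeff α q.2 * ‖z‖ ^ q.2))) ?_
    filter_upwards [ae_weighted_norm_lt n α] with ζ hζ using hFn q ζ hζ
  have hs := (hasSum_binomCoeff_rpow α (norm_nonneg z) hz).summable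
  have hFs : Summable fun q => ∫ ζ, ‖F q ζ‖ ∂(weighted n α) := by
    refine Summable.of_nonneg_of_le (fun q => integral_nonneg fun ζ => norm_nonneg _)
      (f := fun q : ℕ × ℕ => (weighted n α).real Set.univ *
        (‖v‖ * ((binomCoeff α q.1 * ‖z‖ ^ q.1) * (binomCoeff α q.2 * ‖z‖ ^ q.2)))) (fun q => ?_) ?_
    · calc ∫ ζ, ‖F q ζ‖ ∂(weighted n α) ≤ ∫ ζ, (‖v‖ * ((binomCoeff α q.1 * ‖z‖ ^ q.1) *
            (binomCoeff α q.2 * ‖z‖ ^ q.2))) ∂(weighted n α) := by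
            refine integral_mono_ae (hFi q).norm (integrable_const _) ?_
            filter_upwards [ae_weighted_norm_lt n α] with ζ hζ using hFn q ζ hζ
        _ = _ := by rw [integral_const, smul_eq_mul]
    · exact ((hs.mul_of_nonneg hs (fun k => mul_nonneg (hb k) (by positivity))
        (fun k => mul_nonneg (hb k) (by positivity))).mul_left _).mul_left _
  have h1 := hasSum_integral_of_summable_integral_norm hFi hFs
  have h2 : ∫ ζ, ∑' q, F q ζ ∂(weighted n α) =
      ((∫ ζ, ‖(inner ℂ v ζ : ℂ)‖ * ‖1 - inner ℂ z ζ‖ ^ (-(2 * α)) ∂(weighted n α) : ℝ) : ℂ) := by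
    rw [← integral_complex_ofReal]
    refine integral_congr_ae ?_
    filter_upwards [ae_weighted_norm_lt n α] with ζ hζ
    have hx : ‖(inner ℂ z ζ : ℂ)‖ < 1 := (norm_inner_le_norm z ζ).trans_lt
      ((mul_le_of_le_one_right (norm_nonneg _) hζ.le).trans_lt hz)
    have := (hasSum_norm_one_sub_rpow hα hx).mul_left (‖(inner ℂ v ζ : ℂ)‖ : ℂ)
    push_cast at this ⊢
    rw [← this.tsum_eq]
    refine tsum_congr fun q => ?_
    simp only [F]
    ring
  rw [h2] at h1
  have hinj : Function.Injective fun k : ℕ => (k, k) := fun a b h => (Prod.ext_iff.1 h).1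
  rw [← hinj.hasSum_iff] at h1
  · rw [← Complex.hasSum_ofReal]
    refine (congrArg (HasSum · _) (funext fun k => ?_)).mpr h1
    simp only [F, Function.comp_apply]
    rw [integral_const_mul, Complex.ofReal_mul, ← integral_complex_ofReal]
    congr 1
    · push_cast; ring
    · congr 1
      ext ζ
      rw [← mul_pow, Complex.mul_conj, Complex.normSq_eq_norm_sq]
      push_cast
      ring
  · rintro ⟨j, k⟩ hq
    have hjk : j ≠ k := fun h => hq ⟨j, by rw [h]⟩
    simp only [F]
    rw [integral_const_mul, integral_mul_pow_mul_conj_pow_eq_zero α v z hjk, mul_zero]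

/-! ### Derivative of the Berezin kernel -/

/-- The vector `G` for which the derivative of the Berezin kernel `K(·, w)` at `z` in the
direction `h` is `2 (n + 1) K(z, w) Re ⟨h, G⟩`. -/
def logGrad {n : ℕ} (z w : Cn n) : Cn n :=
  (1 - inner ℂ z w : ℂ)⁻¹ • w - ((1 - ‖z‖ ^ 2 : ℝ) : ℂ)⁻¹ • z

/-- The real derivative of the Berezin kernel in its first variable. -/
def kernelDeriv {n : ℕ} (z w : Cn n) : Cn n →L[ℝ] ℝ :=
  (2 * ((n : ℝ) + 1) * kernel z w) •
    Complex.reCLM.comp (ContinuousLinearMap.restrictScalarsL ℂ (Cn n) ℂ ℝ ℝ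
      (innerSL ℂ (logGrad z w)))

lemma kernelDeriv_apply {n : ℕ} (z w h : Cn n) :
    kernelDeriv z w h = 2 * ((n : ℝ) + 1) * kernel z w * (inner ℂ (logGrad z w) h : ℂ).re := rfl

lemma real_inner_eq_re {n : ℕ} (z w : Cn n) : inner ℝ z w = (inner ℂ z w : ℂ).re := by
  simp [PiLp.inner_apply]

lemma re_inner_logGrad {n : ℕ} (z w h : Cn n) :
    (inner ℂ (logGrad z w) h : ℂ).re =
      ((inner ℂ h w : ℂ).re - (inner ℂ h w * inner ℂ w z : ℂ).re) / ‖1 - inner ℂ z w‖ ^ 2 -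
        (1 - ‖z‖ ^ 2)⁻¹ * (inner ℂ z h : ℂ).re := by
  have e : (inner ℂ w h : ℂ) = conj (inner ℂ h w) := (inner_conj_symm w h).symm
  have e' : (inner ℂ z w : ℂ) = conj (inner ℂ w z) := (inner_conj_symm z w).symm
  rw [logGrad, inner_sub_left, inner_smul_left, inner_smul_left, Complex.sub_re,
    ← Complex.ofReal_inv, Complex.conj_ofReal, Complex.re_ofReal_mul, map_inv₀, e, e',
    Complex.inv_def,
    ← Complex.normSq_eq_norm_sq]
  simp only [map_sub, map_one, Complex.conj_conj, Complex.mul_re, Complex.mul_im, Complex.sub_re,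
    Complex.sub_im, Complex.one_re, Complex.one_im, Complex.conj_re, Complex.conj_im,
    Complex.ofReal_re, Complex.ofReal_im, Complex.normSq_apply]
  ring

lemma hasFDerivAt_kernel {n : ℕ} {z w : Cn n} (hz : ‖z‖ < 1) (hw : ‖w‖ ≤ 1) :
    HasFDerivAt (fun z => kernel z w) (kernelDeriv z w) z := by
  have hD := one_sub_inner_ne_zero hz hw
  have hN : ‖1 - inner ℂ z w‖ ^ 2 ≠ 0 := by simpa using hD
  have hs : 1 - ‖z‖ ^ 2 ≠ 0 := by nlinarith [norm_nonneg z]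
  have h1 : HasFDerivAt (fun x : Cn n => 1 - (inner ℂ x w : ℂ)) _ z :=
    ((hasFDerivAt_id z).inner ℂ (hasFDerivAt_const w z)).const_sub 1
  have h2 := h1.norm_sq
  have h3 : HasFDerivAt (fun x : Cn n => 1 - ‖x‖ ^ 2) _ z :=
    ((hasFDerivAt_id z).norm_sq).const_sub 1
  have h4 := ((h3.mul ((hasDerivAt_inv hN).comp_hasFDerivAt z h2)).pow (n + 1))
  have h5 : (fun z => kernel z w) = fun x : Cn n =>
      ((1 - ‖x‖ ^ 2) * (‖1 - (inner ℂ x w : ℂ)‖ ^ 2)⁻¹) ^ (n + 1) := by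
    ext x
    rw [kernel_eq_inner, ← div_eq_mul_inv, div_pow, ← pow_mul]
    rfl
  rw [h5]
  refine h4.congr_fderiv ?_
  ext h
  rw [kernelDeriv_apply, kernel_eq_inner]
  have h6 : (0 : ℝ) < ‖1 - (inner ℂ z w : ℂ)‖ := norm_pos_iff.2 hD
  simp only [Function.comp_apply, Pi.mul_apply, add_apply, smul_apply, neg_apply, zero_apply,
    ContinuousLinearMap.comp_apply, innerSL_apply_apply, fderivInnerCLM_apply,
    ContinuousLinearMap.prod_apply, ContinuousLinearMap.id_apply, id_eq, inner_zero_right, zero_add,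
    Complex.inner, smul_eq_mul, nsmul_eq_mul, re_inner_logGrad, real_inner_eq_re]
  rw [show conj (1 - (inner ℂ z w : ℂ)) = 1 - inner ℂ w z by simp]
  have h7 : ∀ x y : ℂ, (-x * (1 - y)).re = -(x.re - (x * y).re) := fun x y => by
    rw [neg_mul, mul_sub, mul_one, Complex.neg_re, Complex.sub_re]
  rw [h7, mul_pow, inv_pow, ← pow_mul, Nat.add_sub_cancel]
  push_cast
  generalize 1 - ‖z‖ ^ 2 = A at *
  field_simp
  ring

/-! ### Differentiation under the integral sign -/

lemma continuousOn_kernel (n : ℕ) :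
    ContinuousOn (fun q : Cn n × Cn n => kernel q.1 q.2)
      (Metric.ball 0 1 ×ˢ Metric.closedBall 0 1) := by
  simp only [kernel_eq_inner]
  refine ContinuousOn.div (by fun_prop) (by fun_prop) fun q hq => ?_
  have h1 : ‖q.1‖ < 1 := mem_ball_zero_iff.1 hq.1
  have h2 : ‖q.2‖ ≤ 1 := mem_closedBall_zero_iff.1 hq.2
  exact pow_ne_zero _ (norm_ne_zero_iff.2 (one_sub_inner_ne_zero h1 h2))

lemma continuousOn_logGrad (n : ℕ) :
    ContinuousOn (fun q : Cn n × Cn n => logGrad q.1 q.2)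
      (Metric.ball 0 1 ×ˢ Metric.closedBall 0 1) := by
  have h1 : ∀ q ∈ (Metric.ball 0 1 ×ˢ Metric.closedBall 0 1 : Set (Cn n × Cn n)),
      (1 - inner ℂ q.1 q.2 : ℂ) ≠ 0 := fun q hq =>
    one_sub_inner_ne_zero (mem_ball_zero_iff.1 hq.1) (mem_closedBall_zero_iff.1 hq.2)
  have h2 : ∀ q ∈ (Metric.ball 0 1 ×ˢ Metric.closedBall 0 1 : Set (Cn n × Cn n)),
      ((1 - ‖q.1‖ ^ 2 : ℝ) : ℂ) ≠ 0 := fun q hq => by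
    have := mem_ball_zero_iff.1 hq.1
    exact Complex.ofReal_ne_zero.2 (by nlinarith [norm_nonneg q.1])
  exact ((ContinuousOn.inv₀ (by fun_prop) h1).smul continuousOn_snd).sub
    ((ContinuousOn.inv₀ (Complex.continuous_ofReal.comp_continuousOn (by fun_prop)) h2).smul
      continuousOn_fst)

lemma continuousOn_kernelDeriv (n : ℕ) :
    ContinuousOn (fun q : Cn n × Cn n => kernelDeriv q.1 q.2)
      (Metric.ball 0 1 ×ˢ Metric.closedBall 0 1) := by
  have h : Continuous fun v : Cn n => Complex.reCLM.comp
      (ContinuousLinearMap.restrictScalarsL ℂ (Cn n) ℂ ℝ ℝ (innerSL ℂ v)) := by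
    refine continuous_const.clm_comp ?_
    exact (ContinuousLinearMap.restrictScalarsL ℂ (Cn n) ℂ ℝ ℝ).continuous.comp
      (innerSL ℂ).continuous
  exact (continuousOn_const.mul (continuousOn_kernel n)).smul
    (h.comp_continuousOn (continuousOn_logGrad n))

lemma exists_bound_of_continuousOn_ball {n : ℕ} {F : Type*} [NormedAddCommGroup F]
    {g : Cn n × Cn n → F} (hg : ContinuousOn g (Metric.ball 0 1 ×ˢ Metric.closedBall 0 1))
    {ρ : ℝ} (hρ : ρ < 1) : ∃ C, ∀ z w : Cn n, ‖z‖ ≤ ρ → ‖w‖ ≤ 1 → ‖g (z, w)‖ ≤ C := by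
  obtain ⟨C, hC⟩ := ((isCompact_closedBall (0 : Cn n) ρ).prod
    (isCompact_closedBall (0 : Cn n) 1)).exists_bound_of_continuousOn
    (hg.mono (Set.prod_mono (Metric.closedBall_subset_ball hρ) subset_rfl))
  exact ⟨C, fun z w hz hw => hC (z, w) ⟨mem_closedBall_zero_iff.2 hz, mem_closedBall_zero_iff.2 hw⟩⟩

lemma aestronglyMeasurable_weighted_of_continuousOn {n : ℕ} (α : ℝ) {F : Type*}
    [NormedAddCommGroup F] [SecondCountableTopology F] {g : Cn n × Cn n → F}
    (hg : ContinuousOn g (Metric.ball 0 1 ×ˢ Metric.closedBall 0 1)) {z : Cn n} (hz : ‖z‖ < 1) :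
    AEStronglyMeasurable (fun w => g (z, w)) (weighted n α) := by
  have h : ContinuousOn (fun w => g (z, w)) (unitBall n) :=
    hg.comp (by fun_prop) fun w hw =>
      ⟨mem_ball_zero_iff.2 hz, Metric.ball_subset_closedBall hw⟩
  exact (h.aestronglyMeasurable (measurableSet_unitBall n)).mono_ac
    (weighted_absolutelyContinuous n α)

lemma MemLinf.ae_bound {n : ℕ} {f : Cn n → ℂ} (hf : MemLinf f) (α : ℝ) :
    ∀ᵐ w ∂(weighted n α), ‖f w‖ ≤ (normLinf f).toReal := by
  have h : ∀ᵐ w ∂(ballVol n), ‖f w‖ₑ ≤ eLpNorm f ⊤ (ballVol n) := by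
    rw [eLpNorm_exponent_top]; exact ae_le_eLpNormEssSup
  filter_upwards [(weighted_absolutelyContinuous n α).ae_le h] with w hw
  rw [normLinf, ← toReal_enorm]
  exact ENNReal.toReal_mono hf.2.ne hw

lemma MemLinf.aestronglyMeasurable {n : ℕ} {f : Cn n → ℂ} (hf : MemLinf f) (α : ℝ) :
    AEStronglyMeasurable f (weighted n α) :=
  hf.1.mono_ac (weighted_absolutelyContinuous n α)

/-- Integrability of a bounded continuous family against a function in `L^∞`. -/
lemma integrable_smul_of_continuousOn {n : ℕ} (hn : 0 < n) {α : ℝ} (hα : -1 < α) {F : Type*}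
    [NormedAddCommGroup F] [SecondCountableTopology F] [NormedSpace ℂ F]
    {g : Cn n × Cn n → F} (hg : ContinuousOn g (Metric.ball 0 1 ×ˢ Metric.closedBall 0 1))
    {f : Cn n → ℂ} (hf : MemLinf f) {z : Cn n} (hz : ‖z‖ < 1) :
    Integrable (fun w => f w • g (z, w)) (weighted n α) := by
  have := isFiniteMeasure_weighted hn hα
  obtain ⟨C, hC⟩ := exists_bound_of_continuousOn_ball hg hz
  refine Integrable.of_bound ((hf.aestronglyMeasurable α).smul
    (aestronglyMeasurable_weighted_of_continuousOn α hg hz)) ((normLinf f).toReal * C) ?_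
  filter_upwards [hf.ae_bound α, ae_weighted_norm_lt n α] with w h1 h2
  rw [norm_smul]
  exact mul_le_mul h1 (hC z w le_rfl h2.le) (norm_nonneg _) ENNReal.toReal_nonneg

lemma berezin_eq {n : ℕ} (α : ℝ) (f : Cn n → ℂ) (z : Cn n) :
    berezin n α f z = (cConst n α : ℂ) * ∫ w, f w • (kernel z w : ℂ) ∂(weighted n α) := by
  rw [berezin, integral_weighted]
  congr 2
  ext w
  rw [Complex.real_smul, smul_eq_mul]
  ring

/-- The integral that represents the derivative of the Berezin transform. -/
def berezinDeriv (n : ℕ) (α : ℝ) (f : Cn n → ℂ) (z : Cn n) : Cn n →L[ℝ] ℂ :=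
  (cConst n α : ℂ) • ∫ w, (kernelDeriv z w).smulRight (f w) ∂(weighted n α)

lemma norm_kernelDeriv_smulRight (n : ℕ) (z w : Cn n) (c : ℂ) :
    ‖(kernelDeriv z w).smulRight c‖ = ‖c‖ * ‖kernelDeriv z w‖ := by
  rw [ContinuousLinearMap.norm_smulRight_apply, mul_comm]

lemma aestronglyMeasurable_kernelDeriv_smulRight {n : ℕ} (α : ℝ) {f : Cn n → ℂ} (hf : MemLinf f)
    {z : Cn n} (hz : ‖z‖ < 1) :
    AEStronglyMeasurable (fun w => (kernelDeriv z w).smulRight (f w)) (weighted n α) :=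
  (ContinuousLinearMap.smulRightL ℝ (Cn n) ℂ).aestronglyMeasurable_comp₂
    (aestronglyMeasurable_weighted_of_continuousOn α (continuousOn_kernelDeriv n) hz)
    (hf.aestronglyMeasurable α)

/-- On a ball of radius `ρ < 1` the differentiated integrands have a common bound. -/
lemma exists_bound_kernelDeriv_smulRight {n : ℕ} (α : ℝ) {f : Cn n → ℂ} (hf : MemLinf f) {ρ : ℝ}
    (hρ : ρ < 1) : ∃ C, ∀ᵐ w ∂(weighted n α), ∀ z ∈ Metric.closedBall (0 : Cn n) ρ,
      ‖(kernelDeriv z w).smulRight (f w)‖ ≤ C := by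
  obtain ⟨C, hC⟩ := exists_bound_of_continuousOn_ball (continuousOn_kernelDeriv n) hρ
  refine ⟨(normLinf f).toReal * C, ?_⟩
  filter_upwards [hf.ae_bound α, ae_weighted_norm_lt n α] with w h1 h2 z hz
  rw [norm_kernelDeriv_smulRight]
  exact mul_le_mul h1 (hC z w (mem_closedBall_zero_iff.1 hz) h2.le) (norm_nonneg _)
    ENNReal.toReal_nonneg

lemma exists_closedBall_mem_nhds {n : ℕ} {z : Cn n} (hz : ‖z‖ < 1) :
    ∃ ρ < 1, Metric.closedBall (0 : Cn n) ρ ∈ nhds z := by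
  refine ⟨(‖z‖ + 1) / 2, by linarith, Filter.mem_of_superset
    (Metric.isOpen_ball.mem_nhds (mem_ball_zero_iff.2 ?_)) Metric.ball_subset_closedBall⟩
  linarith

lemma integrable_kernelDeriv_smulRight {n : ℕ} (hn : 0 < n) {α : ℝ} (hα : -1 < α) {f : Cn n → ℂ}
    (hf : MemLinf f) {z : Cn n} (hz : ‖z‖ < 1) :
    Integrable (fun w => (kernelDeriv z w).smulRight (f w)) (weighted n α) := by
  have := isFiniteMeasure_weighted hn hα
  obtain ⟨C, hC⟩ := exists_bound_kernelDeriv_smulRight α hf hz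
  refine Integrable.of_bound (aestronglyMeasurable_kernelDeriv_smulRight α hf hz) C ?_
  filter_upwards [hC] with w hw using hw z (mem_closedBall_zero_iff.2 le_rfl)

lemma hasFDerivAt_berezin {n : ℕ} (hn : 0 < n) {α : ℝ} (hα : -1 < α) {f : Cn n → ℂ}
    (hf : MemLinf f) {z : Cn n} (hz : ‖z‖ < 1) :
    HasFDerivAt (berezin n α f) (berezinDeriv n α f z) z := by
  have := isFiniteMeasure_weighted hn hα
  have hc : ContinuousOn (fun q : Cn n × Cn n => (kernel q.1 q.2 : ℂ))
      (Metric.ball 0 1 ×ˢ Metric.closedBall 0 1) :=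
    Complex.continuous_ofReal.comp_continuousOn (continuousOn_kernel n)
  obtain ⟨ρ, hρ, hmem⟩ := exists_closedBall_mem_nhds hz
  obtain ⟨C, hC⟩ := exists_bound_kernelDeriv_smulRight α hf hρ
  have h1 : HasFDerivAt (fun z => ∫ w, f w • (kernel z w : ℂ) ∂(weighted n α))
      (∫ w, (kernelDeriv z w).smulRight (f w) ∂(weighted n α)) z := by
    refine hasFDerivAt_integral_of_dominated_of_fderiv_le (bound := fun _ => C) hmem ?_
      (integrable_smul_of_continuousOn hn hα hc hf hz)
      (aestronglyMeasurable_kernelDeriv_smulRight α hf hz) hC (integrable_const _) ?_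
    · filter_upwards [hmem] with x hx
      have hx1 : ‖x‖ < 1 := (mem_closedBall_zero_iff.1 hx).trans_lt hρ
      exact (integrable_smul_of_continuousOn hn hα hc hf hx1).1
    · filter_upwards [ae_weighted_norm_lt n α] with w hw x hx
      have hx1 : ‖x‖ < 1 := (mem_closedBall_zero_iff.1 hx).trans_lt hρ
      have h := (Complex.ofRealCLM.hasFDerivAt.comp x (hasFDerivAt_kernel hx1 hw.le)).const_smul
        (f w)
      refine h.congr_fderiv ?_
      ext v
      simp [mul_comm]
  rw [show berezin n α f = fun z => (cConst n α : ℂ) * ∫ w, f w • (kernel z w : ℂ) ∂(weighted n α)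
    from funext fun z => berezin_eq α f z]
  exact h1.const_smul (cConst n α : ℂ)

lemma contDiffOn_berezin {n : ℕ} (hn : 0 < n) {α : ℝ} (hα : -1 < α) {f : Cn n → ℂ}
    (hf : MemLinf f) : ContDiffOn ℝ 1 (berezin n α f) (unitBall n) := by
  have := isFiniteMeasure_weighted hn hα
  have hd : ∀ z ∈ unitBall n, HasFDerivAt (berezin n α f) (berezinDeriv n α f z) z :=
    fun z hz => hasFDerivAt_berezin hn hα hf (mem_ball_zero_iff.1 hz)
  have h := (contDiffOn_succ_iff_fderiv_of_isOpen (𝕜 := ℝ) (n := 0) (f := berezin n α f)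
    (s := unitBall n) Metric.isOpen_ball).2
  rw [zero_add] at h
  refine h ⟨fun z hz => (hd z hz).differentiableAt.differentiableWithinAt, by simp, ?_⟩
  rw [contDiffOn_zero]
  refine ContinuousOn.congr (f := berezinDeriv n α f) ?_ fun z hz => (hd z hz).fderiv
  suffices hc : ContinuousOn (fun z => ∫ w, (kernelDeriv z w).smulRight (f w) ∂(weighted n α))
    (unitBall n) from
    hc.const_smul (cConst n α : ℂ)
  refine fun z hz => ContinuousAt.continuousWithinAt ?_
  have hz1 : ‖z‖ < 1 := mem_ball_zero_iff.1 hz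
  obtain ⟨ρ, hρ, hmem⟩ := exists_closedBall_mem_nhds hz1
  obtain ⟨C, hC⟩ := exists_bound_kernelDeriv_smulRight α hf hρ
  refine continuousAt_of_dominated (bound := fun _ => C) ?_ ?_ (integrable_const _) ?_
  · filter_upwards [hmem] with x hx
    exact aestronglyMeasurable_kernelDeriv_smulRight α hf
      ((mem_closedBall_zero_iff.1 hx).trans_lt hρ)
  · filter_upwards [hmem] with x hx
    filter_upwards [hC] with w hw using hw x hx
  · filter_upwards [ae_weighted_norm_lt n α] with w hw
    have h1 : ContinuousOn (fun x => kernelDeriv x w) (Metric.ball 0 1) :=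
      ContinuousOn.comp (f := fun x : Cn n => (x, w)) (continuousOn_kernelDeriv n)
        (by fun_prop) fun x hx => ⟨hx, mem_closedBall_zero_iff.2 hw.le⟩
    have h2 : ContinuousAt (fun x => kernelDeriv x w) z :=
      h1.continuousAt (Metric.isOpen_ball.mem_nhds hz)
    have h3 : Continuous fun T : Cn n →L[ℝ] ℝ => T.smulRight (f w) :=
      ((ContinuousLinearMap.smulRightL ℝ (Cn n) ℂ).flip (f w)).continuous
    exact ContinuousAt.comp (f := fun x => kernelDeriv x w)
      (g := fun T : Cn n →L[ℝ] ℝ => T.smulRight (f w)) h3.continuousAt h2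

/-- The conjugate gradient of the Berezin transform as a vector valued integral. -/
lemma gradZbar_berezin {n : ℕ} (hn : 0 < n) {α : ℝ} (hα : -1 < α) {f : Cn n → ℂ}
    (hf : MemLinf f) {z : Cn n} (hz : ‖z‖ < 1) :
    gradZbar (berezin n α f) z = ((cConst n α * (n + 1) : ℝ) : ℂ) •
      ∫ w, f w • ((kernel z w : ℂ) • logGrad z w) ∂(weighted n α) := by
  have hg : ContinuousOn (fun q : Cn n × Cn n => (kernel q.1 q.2 : ℂ) • logGrad q.1 q.2)
      (Metric.ball 0 1 ×ˢ Metric.closedBall 0 1) :=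
    (Complex.continuous_ofReal.comp_continuousOn (continuousOn_kernel n)).smul
      (continuousOn_logGrad n)
  have hG := integrable_smul_of_continuousOn hn hα hg hf hz
  have hK := integrable_kernelDeriv_smulRight hn hα hf hz
  ext j
  have h1 : ∀ h : Cn n, fderiv ℝ (berezin n α f) z h =
      (cConst n α : ℂ) * ∫ w, (kernelDeriv z w h : ℂ) * f w ∂(weighted n α) := by
    intro h
    rw [(hasFDerivAt_berezin hn hα hf hz).fderiv, berezinDeriv, smul_apply,
      ContinuousLinearMap.integral_apply hK, smul_eq_mul]
    simp
  have hi : ∀ h : Cn n, Integrable (fun w => (kernelDeriv z w h : ℂ) * f w) (weighted n α) := by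
    intro h
    have := hK.apply_continuousLinearMap h
    simpa using this
  have h2 : (∫ w, f w • ((kernel z w : ℂ) • logGrad z w) ∂(weighted n α)) j =
      ∫ w, f w * (kernel z w * logGrad z w j) ∂(weighted n α) := by
    have := (EuclideanSpace.proj (𝕜 := ℂ) j).integral_comp_comm hG
    simpa using this.symm
  rw [PiLp.smul_apply, h2, gradZbar]
  simp only [dx, dy, h1]
  rw [mul_left_comm Complex.I, ← integral_const_mul Complex.I, ← mul_add,
    ← integral_add (hi _) ((hi _).const_mul _), mul_div_assoc, ← integral_div, smul_eq_mul,
    Complex.ofReal_mul, mul_assoc,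
    ← integral_const_mul ((n + 1 : ℝ) : ℂ)]
  congr 1
  refine integral_congr_ae (ae_of_all _ fun w => ?_)
  simp only [kernelDeriv_apply, EuclideanSpace.inner_single_right]
  apply Complex.ext <;> simp <;> ring

/-! ### Bounds for the conjugate gradient -/

lemma cConst_pos (n : ℕ) {α : ℝ} (hα : -1 < α) : 0 < cConst n α := by
  have hn : (0 : ℝ) ≤ n := Nat.cast_nonneg n
  have h1 := Real.Gamma_pos_of_pos (show 0 < α + 1 by linarith)
  have h2 := Real.Gamma_pos_of_pos (show 0 < α + n + 1 by linarith)
  rw [cConst]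
  positivity

lemma inner_gradZbar_berezin {n : ℕ} (hn : 0 < n) {α : ℝ} (hα : -1 < α) {f : Cn n → ℂ}
    (hf : MemLinf f) {z : Cn n} (hz : ‖z‖ < 1) (u : Cn n) :
    inner ℂ u (gradZbar (berezin n α f) z) = ((cConst n α * (n + 1) : ℝ) : ℂ) *
      ∫ w, f w * ((kernel z w : ℂ) * inner ℂ u (logGrad z w)) ∂(weighted n α) := by
  have hg : ContinuousOn (fun q : Cn n × Cn n => (kernel q.1 q.2 : ℂ) • logGrad q.1 q.2)
      (Metric.ball 0 1 ×ˢ Metric.closedBall 0 1) :=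
    (Complex.continuous_ofReal.comp_continuousOn (continuousOn_kernel n)).smul
      (continuousOn_logGrad n)
  have hG := integrable_smul_of_continuousOn hn hα hg hf hz
  rw [gradZbar_berezin hn hα hf hz, inner_smul_right, ← integral_inner hG]
  simp only [inner_smul_right]

lemma integrable_kernel_mul_inner {n : ℕ} (hn : 0 < n) {α : ℝ} (hα : -1 < α) {z : Cn n}
    (hz : ‖z‖ < 1) (u : Cn n) :
    Integrable (fun w => kernel z w * ‖(inner ℂ u (logGrad z w) : ℂ)‖) (weighted n α) := by
  have := isFiniteMeasure_weighted hn hα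
  have hg : ContinuousOn (fun q : Cn n × Cn n => kernel q.1 q.2 *
      ‖(inner ℂ u (logGrad q.1 q.2) : ℂ)‖) (Metric.ball 0 1 ×ˢ Metric.closedBall 0 1) :=
    (continuousOn_kernel n).mul (continuousOn_const.inner (𝕜 := ℂ) (continuousOn_logGrad n)).norm
  obtain ⟨C, hC⟩ := exists_bound_of_continuousOn_ball hg hz
  refine Integrable.of_bound (aestronglyMeasurable_weighted_of_continuousOn α hg hz) C ?_
  filter_upwards [ae_weighted_norm_lt n α] with w h2 using hC z w le_rfl h2.le

lemma kernel_nonneg {n : ℕ} {z : Cn n} (hz : ‖z‖ < 1) (w : Cn n) : 0 ≤ kernel z w := by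
  have : 0 ≤ 1 - ‖z‖ ^ 2 := by nlinarith [norm_nonneg z]
  rw [kernel]
  positivity

/-- The change of variables `w = φ_z(ζ)` in the integral that governs the conjugate gradient. -/
lemma integral_kernel_mul_inner {n : ℕ} (α : ℝ) {z : Cn n} (hz : ‖z‖ < 1) (u : Cn n) :
    (1 - ‖z‖ ^ 2) * ∫ w, kernel z w * ‖(inner ℂ u (logGrad z w) : ℂ)‖ ∂(weighted n α) =
      (1 - ‖z‖ ^ 2) ^ α * ∫ ζ, ‖(inner ℂ (contraction z u) ζ : ℂ)‖ *
        ‖1 - inner ℂ z ζ‖ ^ (-(2 * α)) ∂(weighted n α) := by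
  have hs : 0 < 1 - ‖z‖ ^ 2 := by nlinarith [norm_nonneg z]
  have h1 := integral_kernel_smul hz
    (fun w => (1 - ‖w‖ ^ 2) ^ α * ‖(inner ℂ u (logGrad z w) : ℂ)‖)
  have h2 : ∫ w, kernel z w * ‖(inner ℂ u (logGrad z w) : ℂ)‖ ∂(weighted n α) =
      ∫ w, kernel z w • ((1 - ‖w‖ ^ 2) ^ α * ‖(inner ℂ u (logGrad z w) : ℂ)‖) ∂(ballVol n) := by
    rw [integral_weighted]
    refine integral_congr_ae (ae_of_all _ fun w => ?_)
    simp only [smul_eq_mul]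
    ring
  rw [h2, h1, integral_weighted, ← integral_const_mul, ← integral_const_mul]
  refine integral_congr_ae ?_
  filter_upwards [ae_ballVol_norm_lt n] with ζ hζ
  have hD := norm_pos_iff.2 (one_sub_inner_ne_zero hz hζ.le)
  have hζ' : 0 ≤ 1 - ‖ζ‖ ^ 2 := by nlinarith [norm_nonneg ζ]
  have h3 : ((1 - ‖z‖ ^ 2 : ℝ) : ℂ) • logGrad z (mobius z ζ) = -contraction z ζ := by
    have hs' : ((1 - ‖z‖ ^ 2 : ℝ) : ℂ) ≠ 0 := Complex.ofReal_ne_zero.2 hs.ne'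
    rw [← smul_mobius_sub hz hζ, logGrad, smul_sub, smul_smul, smul_smul, mul_inv_cancel₀ hs',
      one_smul, ← Complex.ofReal_pow, defect_sq hz, div_eq_mul_inv]
  have h4 : (1 - ‖z‖ ^ 2) * ‖(inner ℂ u (logGrad z (mobius z ζ)) : ℂ)‖ =
      ‖(inner ℂ (contraction z u) ζ : ℂ)‖ := by
    rw [inner_contraction_left, ← norm_neg (inner ℂ u (contraction z ζ) : ℂ),
      ← inner_neg_right, ← h3, inner_smul_right, norm_mul, Complex.norm_real,
      Real.norm_of_nonneg hs.le]
  have h5 : (1 - ‖mobius z ζ‖ ^ 2) ^ α =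
      (1 - ‖z‖ ^ 2) ^ α * (1 - ‖ζ‖ ^ 2) ^ α * ‖1 - inner ℂ z ζ‖ ^ (-(2 * α)) := by
    rw [one_sub_norm_mobius_sq hz hζ, defect_sq hz, Real.div_rpow (by positivity) (by positivity),
      Real.mul_rpow hs.le hζ', Real.rpow_neg hD.le, div_eq_mul_inv, Real.rpow_mul hD.le,
      Real.rpow_two]
  rw [mul_left_comm, h4, h5, smul_eq_mul]
  ring

lemma exists_inner_eq_norm {n : ℕ} (hn : 0 < n) (V : Cn n) :
    ∃ u : Cn n, ‖u‖ = 1 ∧ inner ℂ u V = (‖V‖ : ℂ) := by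
  obtain ⟨u, hu, hV⟩ := exists_unit_smul hn V
  refine ⟨u, hu, ?_⟩
  conv_lhs => rw [hV]
  rw [inner_smul_right, inner_self_eq_norm_sq_to_K, hu]
  simp

lemma ae_norm_le_one {n : ℕ} (α : ℝ) {f : Cn n → ℂ} (hf : MemLinf f) (hf1 : normLinf f ≤ 1) :
    ∀ᵐ w ∂(weighted n α), ‖f w‖ ≤ 1 := by
  filter_upwards [hf.ae_bound α] with w hw
  exact hw.trans (ENNReal.toReal_mono ENNReal.one_ne_top hf1)

/-- The weighted length of the conjugate gradient is controlled by a scalar integral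
in which `f` no longer appears. -/
lemma exists_gradZbar_berezin_le {n : ℕ} (hn : 0 < n) {α : ℝ} (hα : -1 < α) {f : Cn n → ℂ}
    (hf : MemLinf f) (hf1 : normLinf f ≤ 1) {z : Cn n} (hz : ‖z‖ < 1) :
    ∃ v : Cn n, ‖v‖ ≤ 1 ∧ (1 - ‖z‖ ^ 2) * ‖gradZbar (berezin n α f) z‖ ≤
      (n + 1) * ((1 - ‖z‖ ^ 2) ^ α * (cConst n α * ∫ ζ, ‖(inner ℂ v ζ : ℂ)‖ *
        ‖1 - inner ℂ z ζ‖ ^ (-(2 * α)) ∂(weighted n α))) := by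
  obtain ⟨u, hu, hV⟩ := exists_inner_eq_norm hn (gradZbar (berezin n α f) z)
  refine ⟨contraction z u, (norm_contraction_le hz u).trans hu.le, ?_⟩
  have hs : 0 ≤ 1 - ‖z‖ ^ 2 := by nlinarith [norm_nonneg z]
  have hc := (cConst_pos n hα).le
  have h1 : ‖gradZbar (berezin n α f) z‖ ≤ cConst n α * (n + 1) *
      ∫ w, kernel z w * ‖(inner ℂ u (logGrad z w) : ℂ)‖ ∂(weighted n α) := by
    have h := congrArg norm (inner_gradZbar_berezin hn hα hf hz u)
    rw [hV, norm_mul, Complex.norm_real, Complex.norm_real, norm_norm,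
      Real.norm_of_nonneg (by positivity)] at h
    rw [h]
    refine mul_le_mul_of_nonneg_left ?_ (by positivity)
    refine norm_integral_le_of_norm_le (integrable_kernel_mul_inner hn hα hz u) ?_
    filter_upwards [ae_norm_le_one α hf hf1] with w hw
    rw [norm_mul, norm_mul, Complex.norm_real, Real.norm_of_nonneg (kernel_nonneg hz w)]
    exact mul_le_of_le_one_left (mul_nonneg (kernel_nonneg hz w) (norm_nonneg _)) hw
  calc _ ≤ (1 - ‖z‖ ^ 2) * (cConst n α * (n + 1) *
      ∫ w, kernel z w * ‖(inner ℂ u (logGrad z w) : ℂ)‖ ∂(weighted n α)) := by gcongr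
    _ = (n + 1) * cConst n α * ((1 - ‖z‖ ^ 2) *
      ∫ w, kernel z w * ‖(inner ℂ u (logGrad z w) : ℂ)‖ ∂(weighted n α)) := by ring
    _ = _ := by rw [integral_kernel_mul_inner α hz]; ring

/-- The numbers whose weighted averages bound the Bloch seminorm. -/
def levelConst (n : ℕ) (α : ℝ) (k : ℕ) : ℝ :=
  Real.Gamma (n + α + 1) * binomCoeff α k *
    (Real.Gamma (k + 3 / 2) / Real.Gamma (k + α + n + 3 / 2))

lemma levelConst_eq {n : ℕ} {α : ℝ} (hα : -1 < α) (k : ℕ) :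
    levelConst n α k = cConst n α * binomCoeff α k * moment n α (2 * k + 1) := by
  have h1 := (Real.Gamma_pos_of_pos (show 0 < α + 1 by linarith)).ne'
  rw [levelConst, cConst, moment, show (2 * (k : ℝ) + 1) / 2 + 1 = k + 3 / 2 by ring,
    show α + n + (2 * (k : ℝ) + 1) / 2 + 1 = k + α + n + 3 / 2 by ring,
    show (n : ℝ) + α + 1 = α + n + 1 by ring]
  have := Real.pi_pos.ne'
  field_simp

/-- An average of the numbers `levelConst n α k` with respect to the negative binomial weights
`(1 - x)^α binomCoeff α k x^k`, `x = |z|²`, bounds the scalar integral.  If the numbers outside the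
finite set `T` stay below `A - δ`, then so does the mass of the average outside `T`. -/
lemma weighted_integral_le {n : ℕ} (hn : 0 < n) {α : ℝ} (hα : 0 ≤ α) {v z : Cn n} (hv : ‖v‖ ≤ 1)
    (hz : ‖z‖ < 1) {A δ : ℝ} (T : Finset ℕ) (hT : ∀ k ∈ T, levelConst n α k ≤ A)
    (hT' : ∀ k ∉ T, levelConst n α k ≤ A - δ) :
    (1 - ‖z‖ ^ 2) ^ α * (cConst n α * ∫ ζ, ‖(inner ℂ v ζ : ℂ)‖ *
        ‖1 - inner ℂ z ζ‖ ^ (-(2 * α)) ∂(weighted n α)) ≤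
      A - δ * (1 - (1 - ‖z‖ ^ 2) ^ α * ∑ k ∈ T, binomCoeff α k * (‖z‖ ^ 2) ^ k) := by
  have hα' : -1 < α := by linarith
  have hx : ‖z‖ ^ 2 < 1 := by nlinarith [norm_nonneg z]
  have hs : 0 < 1 - ‖z‖ ^ 2 := by linarith
  have hc := (cConst_pos n hα').le
  set x := ‖z‖ ^ 2
  have hx0 : 0 ≤ x := sq_nonneg _
  have h1 := (hasSum_integral_expansion hn hα v hz).mul_left (cConst n α)
  have h2 := ((hasSum_binomCoeff_rpow α hx0 hx).mul_right (A - δ)).add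
    ((hasSum_sum_of_ne_finset_zero (f := fun k => if k ∈ T then binomCoeff α k * x ^ k else 0)
      (s := T) (fun k hk => by simp [hk])).mul_right δ)
  have h3 := hasSum_le (fun k => ?_) h1 h2
  · calc _ ≤ (1 - x) ^ α * ((1 - x) ^ (-α) * (A - δ) +
        (∑ k ∈ T, if k ∈ T then binomCoeff α k * x ^ k else 0) * δ) := by gcongr
      _ = _ := by
        rw [Finset.sum_congr rfl fun k hk => if_pos hk, mul_add, ← mul_assoc,
          ← Real.rpow_add hs, add_neg_cancel, Real.rpow_zero]
        ring
  · have hb := binomCoeff_nonneg hα k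
    have hm := (moment_pos n hα' (show (0 : ℝ) ≤ 2 * k + 1 by positivity)).le
    have hbx : 0 ≤ binomCoeff α k * x ^ k := by positivity
    calc _ ≤ cConst n α * (binomCoeff α k ^ 2 * (‖v‖ * x ^ k * moment n α (2 * k + 1))) := by
          gcongr
          exact integral_mixed_moment_le_mul hn hα' v z k
      _ ≤ cConst n α * (binomCoeff α k ^ 2 * (1 * x ^ k * moment n α (2 * k + 1))) := by gcongr
      _ = (binomCoeff α k * x ^ k) * levelConst n α k := by rw [levelConst_eq hα']; ring
      _ ≤ _ := by
        by_cases hk : k ∈ T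
        · have := mul_le_mul_of_nonneg_left (hT k hk) hbx
          simp only [hk, if_true]
          linarith
        · have := mul_le_mul_of_nonneg_left (hT' k hk) hbx
          simp only [hk, if_false]
          linarith

lemma levelConst_pos (n : ℕ) {α : ℝ} (hα : 0 < α) (k : ℕ) : 0 < levelConst n α k := by
  have hn : (0 : ℝ) ≤ n := Nat.cast_nonneg n
  have hk : (0 : ℝ) ≤ k := Nat.cast_nonneg k
  have h1 := Real.Gamma_pos_of_pos (show 0 < n + α + 1 by linarith)
  have h2 := Real.Gamma_pos_of_pos (show 0 < (k : ℝ) + 3 / 2 by linarith)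
  have h3 := Real.Gamma_pos_of_pos (show 0 < k + α + n + 3 / 2 by linarith)
  have h4 := binomCoeff_pos hα k
  rw [levelConst]
  positivity

lemma levelConst_succ (n : ℕ) {α : ℝ} (hα : 0 ≤ α) (k : ℕ) :
    levelConst n α (k + 1) * (((k : ℝ) + 1) * (k + α + n + 3 / 2)) =
      levelConst n α k * ((α + k) * (k + 3 / 2)) := by
  have hn : (0 : ℝ) ≤ n := Nat.cast_nonneg n
  have hk : (0 : ℝ) ≤ k := Nat.cast_nonneg k
  have h2 : (0 : ℝ) < (k : ℝ) + 3 / 2 := by linarith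
  have h3 : (0 : ℝ) < k + α + n + 3 / 2 := by linarith
  have h4 := (Real.Gamma_pos_of_pos h3).ne'
  have h5 := succ_mul_binomCoeff_succ α k
  rw [levelConst, levelConst]
  push_cast
  rw [show (k : ℝ) + 1 + 3 / 2 = (k + 3 / 2) + 1 by ring,
    show (k : ℝ) + 1 + α + n + 3 / 2 = (k + α + n + 3 / 2) + 1 by ring,
    Real.Gamma_add_one h2.ne', Real.Gamma_add_one h3.ne']
  field_simp
  linear_combination h5

lemma lt_kIndex_iff (n : ℕ) (α : ℝ) (k : ℕ) :
    k < kIndex n α ↔ ((k : ℝ) + 1) * (k + α + n + 3 / 2) < (α + k) * (k + 3 / 2) := by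
  rw [kIndex, Nat.lt_ceil, lt_div_iff₀ (by positivity)]
  constructor <;> intro h <;> linarith

lemma levelConst_lt_succ {n : ℕ} {α : ℝ} (hα : 0 < α) {k : ℕ} (hk : k < kIndex n α) :
    levelConst n α k < levelConst n α (k + 1) := by
  have h1 := levelConst_succ n hα.le k
  have h2 := mul_lt_mul_of_pos_left ((lt_kIndex_iff n α k).1 hk) (levelConst_pos n hα k)
  rw [← h1] at h2
  exact lt_of_mul_lt_mul_right h2 (by positivity)

lemma levelConst_succ_le {n : ℕ} {α : ℝ} (hα : 0 < α) {k : ℕ} (hk : kIndex n α ≤ k) :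
    levelConst n α (k + 1) ≤ levelConst n α k := by
  have h1 := levelConst_succ n hα.le k
  have h2 := mul_le_mul_of_nonneg_left (not_lt.1 (mt (lt_kIndex_iff n α k).2 (not_lt.2 hk)))
    (levelConst_pos n hα k).le
  rw [← h1] at h2
  exact le_of_mul_le_mul_right h2 (by positivity)

lemma levelConst_succ_lt {n : ℕ} {α : ℝ} (hα : 0 < α) {k : ℕ} (hk : kIndex n α < k) :
    levelConst n α (k + 1) < levelConst n α k := by
  have h1 := levelConst_succ n hα.le k
  obtain ⟨j, rfl⟩ : ∃ j, k = j + 1 := ⟨k - 1, by omega⟩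
  have hj := not_lt.1 (mt (lt_kIndex_iff n α j).2 (not_lt.2 (show kIndex n α ≤ j by omega)))
  have h3 : (α + (j + 1 : ℕ)) * ((j + 1 : ℕ) + 3 / 2) <
      (((j + 1 : ℕ) : ℝ) + 1) * ((j + 1 : ℕ) + α + n + 3 / 2) := by
    have hn : (0 : ℝ) ≤ n := Nat.cast_nonneg n
    push_cast
    linarith
  have h2 := mul_lt_mul_of_pos_left h3 (levelConst_pos n hα (j + 1))
  rw [← h1] at h2
  exact lt_of_mul_lt_mul_right h2 (by positivity)

lemma levelConst_le_of_le_kIndex {n : ℕ} {α : ℝ} (hα : 0 < α) {j k : ℕ} (hjk : j ≤ k)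
    (hk : k ≤ kIndex n α) : levelConst n α j ≤ levelConst n α k := by
  induction k, hjk using Nat.le_induction with
  | base => exact le_rfl
  | succ k hjk ih => exact (ih (by omega)).trans (levelConst_lt_succ hα (by omega)).le

lemma levelConst_le_of_kIndex_le {n : ℕ} {α : ℝ} (hα : 0 < α) {j k : ℕ} (hjk : j ≤ k)
    (hj : kIndex n α ≤ j) : levelConst n α k ≤ levelConst n α j := by
  induction k, hjk using Nat.le_induction with
  | base => exact le_rfl
  | succ k hjk ih => exact (levelConst_succ_le hα (by omega)).trans ih

lemma levelConst_le_kIndex {n : ℕ} {α : ℝ} (hα : 0 < α) (k : ℕ) :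
    levelConst n α k ≤ levelConst n α (kIndex n α) := by
  rcases le_total k (kIndex n α) with h | h
  · exact levelConst_le_of_le_kIndex hα h le_rfl
  · exact levelConst_le_of_kIndex_le hα h le_rfl

/-- The maximum of `levelConst n α` is attained at `kIndex n α`, possibly also at the next index,
and there is a gap below it. -/
lemma exists_levelConst_gap (n : ℕ) {α : ℝ} (hα : 0 < α) :
    ∃ δ > 0, ∀ k ∉ ({kIndex n α, kIndex n α + 1} : Finset ℕ),
      levelConst n α k ≤ levelConst n α (kIndex n α) - δ := by
  set K := kIndex n α
  have h1 : levelConst n α (K + 2) < levelConst n α K :=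
    (levelConst_succ_lt hα (show K < K + 1 by omega)).trans_le (levelConst_succ_le hα le_rfl)
  obtain ⟨δ₀, hδ₀, h0⟩ : ∃ δ > 0, ∀ k < K, levelConst n α k ≤ levelConst n α K - δ := by
    rcases Nat.eq_zero_or_pos K with hK | hK
    · exact ⟨1, one_pos, fun k hk => by omega⟩
    · have h2 := levelConst_lt_succ (n := n) hα (show K - 1 < K by omega)
      rw [Nat.sub_add_cancel hK] at h2
      refine ⟨levelConst n α K - levelConst n α (K - 1), by linarith, fun k hk => ?_⟩
      have := levelConst_le_of_le_kIndex (n := n) hα (show k ≤ K - 1 by omega)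
        (show K - 1 ≤ K by omega)
      linarith
  refine ⟨min δ₀ (levelConst n α K - levelConst n α (K + 2)), lt_min hδ₀ (by linarith),
    fun k hk => ?_⟩
  simp only [Finset.mem_insert, Finset.mem_singleton, not_or] at hk
  rcases lt_or_ge k K with h | h
  · have := h0 k h
    have := min_le_left δ₀ (levelConst n α K - levelConst n α (K + 2))
    linarith
  · have := levelConst_le_of_kIndex_le (n := n) hα (show K + 2 ≤ k by omega)
      (show K ≤ K + 2 by omega)
    have := min_le_right δ₀ (levelConst n α K - levelConst n α (K + 2))
    linarith

/-- The negative binomial mass of the finite set `T`. -/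
def binomMass (α : ℝ) (T : Finset ℕ) (x : ℝ) : ℝ := (1 - x) ^ α * ∑ k ∈ T, binomCoeff α k * x ^ k

lemma binomMass_lt_one {α : ℝ} (hα : 0 < α) {T : Finset ℕ} {x : ℝ} (hx0 : 0 ≤ x) (hx1 : x ≤ 1)
    (h : 0 < x ∨ 0 ∉ T) : binomMass α T x < 1 := by
  rcases hx1.eq_or_lt with rfl | hx
  · simp [binomMass, Real.zero_rpow hα.ne']
  have hs : 0 < 1 - x := by linarith
  have hsum := hasSum_binomCoeff_rpow α hx0 hx
  obtain ⟨m, hm, hpos⟩ : ∃ m ∉ T, 0 < binomCoeff α m * x ^ m := by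
    rcases h with h | h
    · obtain ⟨m, hm⟩ := Infinite.exists_notMem_finset T
      exact ⟨m, hm, mul_pos (binomCoeff_pos hα m) (pow_pos h m)⟩
    · exact ⟨0, h, by simp [binomCoeff_zero]⟩
  have h1 : ∑ k ∈ insert m T, binomCoeff α k * x ^ k ≤ (1 - x) ^ (-α) :=
    sum_le_hasSum _ (fun k _ => mul_nonneg (binomCoeff_nonneg hα.le k) (by positivity)) hsum
  rw [Finset.sum_insert hm] at h1
  have h2 : ∑ k ∈ T, binomCoeff α k * x ^ k < (1 - x) ^ (-α) := by linarith
  calc binomMass α T x < (1 - x) ^ α * (1 - x) ^ (-α) := by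
        rw [binomMass]
        exact mul_lt_mul_of_pos_left h2 (Real.rpow_pos_of_pos hs α)
    _ = 1 := by rw [← Real.rpow_add hs, add_neg_cancel, Real.rpow_zero]

lemma exists_binomMass_le {α : ℝ} (hα : 0 < α) {T : Finset ℕ} {ρ : ℝ} (hρ0 : 0 ≤ ρ) (hρ1 : ρ ≤ 1)
    (h : 0 < ρ ∨ 0 ∉ T) : ∃ η > 0, ∀ x ∈ Set.Icc ρ 1, binomMass α T x ≤ 1 - η := by
  have hc : Continuous (binomMass α T) :=
    ((Real.continuous_rpow_const hα.le).comp (by fun_prop)).mul (by fun_prop)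
  obtain ⟨y, hy, hmax⟩ := isCompact_Icc.exists_isMaxOn ⟨ρ, Set.left_mem_Icc.2 hρ1⟩ hc.continuousOn
  refine ⟨1 - binomMass α T y, ?_, fun x hx => ?_⟩
  · have := binomMass_lt_one hα (hρ0.trans hy.1) hy.2 (h.imp_left fun h => h.trans_le hy.1)
    linarith
  · have : binomMass α T x ≤ binomMass α T y := hmax hx
    linarith

lemma upperConst_eq (n : ℕ) (α : ℝ) :
    upperConst n α = (n + 1) * levelConst n α (kIndex n α) := by
  rw [upperConst, levelConst, binomCoeff]
  ring

lemma sharpConst_eq (n : ℕ) (α : ℝ) : sharpConst n α = (n + 1) * levelConst n α 0 := by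
  rw [sharpConst, levelConst, binomCoeff_zero, ProbabilityTheory.beta]
  have h : Real.Gamma (((0 : ℕ) : ℝ) + 3 / 2) = 1 / 2 * Real.Gamma (1 / 2) := by
    rw [← Real.Gamma_add_one (by norm_num)]
    norm_num
  rw [h, show ((0 : ℕ) : ℝ) + α + n + 3 / 2 = n + α + 1 + 1 / 2 by push_cast; ring]
  ring

lemma sharpConst_eq_moment {n : ℕ} {α : ℝ} (hα : -1 < α) :
    sharpConst n α = cConst n α * (n + 1) * moment n α 1 := by
  rw [sharpConst_eq, levelConst_eq hα, binomCoeff_zero]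
  norm_num
  ring

lemma sharpConst_pos (n : ℕ) {α : ℝ} (hα : -1 < α) : 0 < sharpConst n α := by
  rw [sharpConst_eq_moment hα]
  have := cConst_pos n hα
  have := moment_pos n hα zero_le_one
  positivity

lemma kIndex_eq_zero {n : ℕ} {α : ℝ} (hα : α ≤ 2 * n + 3) : kIndex n α = 0 := by
  rw [kIndex, Nat.ceil_eq_zero]
  exact div_nonpos_of_nonpos_of_nonneg (by linarith) (by positivity)

lemma kIndex_pos {n : ℕ} {α : ℝ} (hα : 2 * n + 3 < α) : 0 < kIndex n α := by
  rw [kIndex, Nat.ceil_pos]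
  exact div_pos (by linarith) (by positivity)

lemma levelConst_zero_alpha {n k : ℕ} (hk : 0 < k) : levelConst n 0 k = 0 := by
  have h : binomCoeff 0 k = 0 := by
    have h1 := factorial_mul_binomCoeff 0 k
    rw [ascPochhammer_eval_zero, if_neg hk.ne'] at h1
    exact (mul_eq_zero.1 h1).resolve_left (by positivity)
  rw [levelConst, h]
  ring

/-- The pointwise bound by `(n + 1)` times the maximal level constant. -/
lemma gradZbar_berezin_le_sharpConst {n : ℕ} (hn : 0 < n) {α : ℝ} (hα : 0 ≤ α)
    (hα' : α ≤ 2 * n + 3) {f : Cn n → ℂ} (hf : MemLinf f) (hf1 : normLinf f ≤ 1) {z : Cn n}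
    (hz : ‖z‖ < 1) :
    (1 - ‖z‖ ^ 2) * ‖gradZbar (berezin n α f) z‖ ≤ sharpConst n α := by
  obtain ⟨v, hv, h⟩ := exists_gradZbar_berezin_le hn (α := α) (by linarith) hf hf1 hz
  have hlev : ∀ k, levelConst n α k ≤ levelConst n α 0 := fun k => by
    rcases hα.eq_or_lt with rfl | hpos
    · rcases Nat.eq_zero_or_pos k with rfl | hk
      · exact le_rfl
      · rw [levelConst_zero_alpha hk]
        have := sharpConst_pos n (show (-1 : ℝ) < 0 by norm_num)
        rw [sharpConst_eq] at this
        exact (pos_of_mul_pos_right this (by positivity)).le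
    · have := levelConst_le_kIndex (n := n) hpos k
      rwa [kIndex_eq_zero hα'] at this
  have h2 := weighted_integral_le hn hα hv hz (A := levelConst n α 0) (δ := 0) ∅ (by simp)
    (fun k _ => by rw [sub_zero]; exact hlev k)
  rw [zero_mul, sub_zero] at h2
  rw [sharpConst_eq]
  exact h.trans (mul_le_mul_of_nonneg_left h2 (by positivity))

/-- The pointwise bound with its gain away from the extremal indices. -/
lemma exists_gradZbar_berezin_gap {n : ℕ} (hn : 0 < n) {α : ℝ} (hα : 0 < α) {ρ : ℝ} (hρ0 : 0 ≤ ρ)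
    (hρ1 : ρ ≤ 1) (h : 0 < ρ ∨ 0 < kIndex n α) :
    ∃ C < upperConst n α, ∀ f : Cn n → ℂ, MemLinf f → normLinf f ≤ 1 → ∀ z : Cn n, ‖z‖ < 1 →
      ρ ≤ ‖z‖ ^ 2 → (1 - ‖z‖ ^ 2) * ‖gradZbar (berezin n α f) z‖ ≤ C := by
  obtain ⟨δ, hδ, hgap⟩ := exists_levelConst_gap n hα
  obtain ⟨η, hη, hmass⟩ := exists_binomMass_le hα (T := {kIndex n α, kIndex n α + 1}) hρ0 hρ1
    (h.imp_right fun h => by simp; omega)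
  have hn1 : (0 : ℝ) < (n : ℝ) + 1 := by positivity
  refine ⟨(n + 1) * (levelConst n α (kIndex n α) - δ * η), ?_, fun f hf hf1 z hz hρz => ?_⟩
  · rw [upperConst_eq]
    have := mul_pos hδ hη
    exact mul_lt_mul_of_pos_left (by linarith) hn1
  · obtain ⟨v, hv, h⟩ := exists_gradZbar_berezin_le hn (α := α) (by linarith) hf hf1 hz
    have h2 := weighted_integral_le hn hα.le hv hz _ (fun k _ => levelConst_le_kIndex hα k) hgap
    refine h.trans (mul_le_mul_of_nonneg_left (h2.trans ?_) hn1.le)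
    have h3 := hmass (‖z‖ ^ 2) ⟨hρz, by nlinarith [norm_nonneg z]⟩
    rw [binomMass] at h3
    have : η ≤ 1 - (1 - ‖z‖ ^ 2) ^ α * ∑ k ∈ {kIndex n α, kIndex n α + 1},
      binomCoeff α k * (‖z‖ ^ 2) ^ k := by linarith
    have := mul_le_mul_of_nonneg_left this hδ.le
    linarith

/-! ### The seminorm and its extremal functions -/

lemma blochZbar_le {n : ℕ} {g : Cn n → ℂ} {C : ℝ}
    (h : ∀ z : Cn n, ‖z‖ < 1 → (1 - ‖z‖ ^ 2) * ‖gradZbar g z‖ ≤ C) :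
    blochZbar g ≤ ENNReal.ofReal C :=
  iSup₂_le fun z hz => ENNReal.ofReal_le_ofReal (h z (mem_ball_zero_iff.1 hz))

lemma le_blochZbar {n : ℕ} (g : Cn n → ℂ) {z : Cn n} (hz : ‖z‖ < 1) :
    ENNReal.ofReal ((1 - ‖z‖ ^ 2) * ‖gradZbar g z‖) ≤ blochZbar g :=
  le_iSup₂_of_le z (mem_ball_zero_iff.2 hz) le_rfl

lemma norm_gradZbar_zero_le_blochZbar {n : ℕ} (g : Cn n → ℂ) :
    ENNReal.ofReal ‖gradZbar g 0‖ ≤ blochZbar g := by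
  have := le_blochZbar g (z := 0) (by simp)
  simpa using this

lemma blochZbar_le_opNormZbar {n : ℕ} {α : ℝ} {f : Cn n → ℂ} (hf : MemLinf f)
    (hf1 : normLinf f ≤ 1) : blochZbar (berezin n α f) ≤ opNormZbar n α :=
  le_iSup₂_of_le f hf (le_iSup_of_le hf1 le_rfl)

lemma kernel_zero {n : ℕ} (w : Cn n) : kernel 0 w = 1 := by simp [kernel_eq_inner]

lemma logGrad_zero {n : ℕ} (w : Cn n) : logGrad 0 w = w := by simp [logGrad]

lemma inner_gradZbar_berezin_zero {n : ℕ} (hn : 0 < n) {α : ℝ} (hα : -1 < α) {f : Cn n → ℂ}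
    (hf : MemLinf f) (u : Cn n) :
    inner ℂ u (gradZbar (berezin n α f) 0) = ((cConst n α * (n + 1) : ℝ) : ℂ) *
      ∫ w, f w * inner ℂ u w ∂(weighted n α) := by
  rw [inner_gradZbar_berezin hn hα hf (by simp)]
  simp only [kernel_zero, logGrad_zero, Complex.ofReal_one, one_mul]

lemma integral_norm_inner {n : ℕ} (hn : 0 < n) {α : ℝ} (hα : -1 < α) {e : Cn n} (he : ‖e‖ = 1) :
    ∫ ζ, ‖(inner ℂ e ζ : ℂ)‖ ∂(weighted n α) = moment n α 1 := by
  rw [← integral_weighted_inner_rpow hn hα zero_le_one he]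
  simp

lemma ofReal_norm_div_mul_self (x : ℂ) : ((‖x‖ : ℂ) / x) * x = ‖x‖ := by
  by_cases hx : x = 0
  · simp [hx]
  · field_simp

/-- At the origin the extremal functions reach at least the sharp constant. -/
lemma sharpConst_le_norm_gradZbar {n : ℕ} (hn : 0 < n) {α : ℝ} (hα : -1 < α) {f : Cn n → ℂ}
    (hf : MemLinf f) (hE : IsExtremalZbar f) :
    sharpConst n α ≤ ‖gradZbar (berezin n α f) 0‖ := by
  obtain ⟨a, C, ha, hC, hfa⟩ := hE
  have h1 := inner_gradZbar_berezin_zero hn hα hf a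
  have h2 : ∫ w, f w * inner ℂ a w ∂(weighted n α) = C * (moment n α 1 : ℂ) := by
    rw [← integral_norm_inner hn hα ha, ← integral_complex_ofReal, ← integral_const_mul]
    refine integral_congr_ae ?_
    filter_upwards [(weighted_absolutelyContinuous n α).ae_le hfa] with w hw
    rw [hw, herm_eq_inner, mul_assoc, ofReal_norm_div_mul_self]
  have hc := cConst_pos n hα
  have hm := moment_pos n hα zero_le_one
  have h3 := congrArg norm h1
  rw [h2, norm_mul, norm_mul, hC, Complex.norm_real, Complex.norm_real, one_mul,
    Real.norm_of_nonneg (by positivity), Real.norm_of_nonneg hm.le, ← sharpConst_eq_moment hα] at h3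
  rw [← h3]
  simpa [ha] using norm_inner_le_norm (𝕜 := ℂ) a (gradZbar (berezin n α f) 0)

lemma ae_inner_ne_zero {n : ℕ} {u : Cn n} (hu : ‖u‖ = 1) :
    ∀ᵐ w ∂(ballVol n), (inner ℂ u w : ℂ) ≠ 0 := by
  let S : Submodule ℝ (Cn n) := (LinearMap.ker (innerSL ℂ u : Cn n →ₗ[ℂ] ℂ)).restrictScalars ℝ
  have hS : S ≠ ⊤ := by
    intro h
    have : u ∈ S := h ▸ Submodule.mem_top
    have h0 : (inner ℂ u u : ℂ) = 0 := this
    rw [inner_self_eq_zero] at h0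
    simp [h0] at hu
  have h := Measure.addHaar_submodule (volume : Measure (Cn n)) S hS
  refine ae_restrict_of_ae ?_
  filter_upwards [compl_mem_ae_iff.2 h] with w hw
  exact hw

/-- If the conjugate gradient at the origin has maximal length, then `f` is extremal. -/
lemma isExtremalZbar_of_norm_gradZbar {n : ℕ} (hn : 0 < n) {α : ℝ} (hα : -1 < α) {f : Cn n → ℂ}
    (hf : MemLinf f) (hf1 : normLinf f ≤ 1)
    (h : ‖gradZbar (berezin n α f) 0‖ = sharpConst n α) : IsExtremalZbar f := by
  obtain ⟨u, hu, hV⟩ := exists_inner_eq_norm hn (gradZbar (berezin n α f) 0)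
  have hc := cConst_pos n hα
  have hI : ∫ w, f w * inner ℂ u w ∂(weighted n α) = (moment n α 1 : ℂ) := by
    have h1 := inner_gradZbar_berezin_zero hn hα hf u
    have hne : ((cConst n α * (n + 1) : ℝ) : ℂ) ≠ 0 := Complex.ofReal_ne_zero.2 (by positivity)
    rw [hV, h, sharpConst_eq_moment hα, Complex.ofReal_mul] at h1
    exact (mul_left_cancel₀ hne h1).symm
  have hc : ContinuousOn (fun q : Cn n × Cn n => (inner ℂ u q.2 : ℂ))
      (Metric.ball 0 1 ×ˢ Metric.closedBall 0 1) := by fun_prop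
  have hint : Integrable (fun w => f w * inner ℂ u w) (weighted n α) :=
    integrable_smul_of_continuousOn hn hα hc hf (z := 0) (by simp)
  have hint2 : Integrable (fun w : Cn n => ‖(inner ℂ u w : ℂ)‖) (weighted n α) :=
    integrable_weighted_of_continuous hn hα (by fun_prop)
  have hle : (fun w => (f w * inner ℂ u w).re) ≤ᵐ[weighted n α]
      fun w => ‖(inner ℂ u w : ℂ)‖ := by
    filter_upwards [ae_norm_le_one α hf hf1] with w hw
    refine (Complex.re_le_norm _).trans ?_
    rw [norm_mul]
    exact mul_le_of_le_one_left (norm_nonneg _) hw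
  have heq : ∫ w, (f w * inner ℂ u w).re ∂(weighted n α) =
      ∫ w, ‖(inner ℂ u w : ℂ)‖ ∂(weighted n α) := by
    have := integral_re hint
    simp only [RCLike.re_eq_complex_re] at this
    rw [this, hI, integral_norm_inner hn hα hu, Complex.ofReal_re]
  have hae := (integral_eq_iff_of_ae_le hint.re hint2 hle).1 heq
  refine ⟨u, 1, hu, norm_one, ?_⟩
  have hae' := (ballVol_absolutelyContinuous n α).ae_le hae
  have h1 := (ballVol_absolutelyContinuous n α).ae_le (ae_norm_le_one α hf hf1)
  filter_upwards [hae', h1, ae_inner_ne_zero hu] with w hw hw1 hne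
  have hw' : (f w * inner ℂ u w).re = ‖(inner ℂ u w : ℂ)‖ := hw
  have hnorm : ‖f w * inner ℂ u w‖ ≤ (f w * inner ℂ u w).re := by
    rw [hw', norm_mul]
    exact mul_le_of_le_one_left (norm_nonneg _) hw1
  have h2 : f w * inner ℂ u w = ((‖(inner ℂ u w : ℂ)‖ : ℝ) : ℂ) := by
    rw [← hw']
    have := Complex.abs_re_le_norm (f w * inner ℂ u w)
    have him : (f w * inner ℂ u w).im = 0 := by
      rw [← Complex.abs_re_eq_norm]
      exact le_antisymm this (hnorm.trans (le_abs_self _))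
    exact Complex.ext (by simp) (by simp [him])
  rw [one_mul, herm_eq_inner, ← h2, mul_div_cancel_right₀ _ hne]

lemma norm_div_self_le_one (x : ℂ) : ‖(‖x‖ : ℂ) / x‖ ≤ 1 := by
  rw [norm_div, Complex.norm_real, norm_norm]
  exact div_self_le_one _

lemma exists_isExtremalZbar {n : ℕ} (hn : 0 < n) :
    ∃ f : Cn n → ℂ, MemLinf f ∧ normLinf f ≤ 1 ∧ IsExtremalZbar f := by
  obtain ⟨e, he, -⟩ := exists_unit_smul hn (0 : Cn n)
  have hb : ∀ᵐ w ∂(ballVol n), ‖(‖herm w e‖ : ℂ) / herm w e‖ ≤ 1 :=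
    ae_of_all _ fun w => norm_div_self_le_one _
  have hm : AEStronglyMeasurable (fun w : Cn n => (‖herm w e‖ : ℂ) / herm w e) (ballVol n) := by
    simp only [herm_eq_inner]
    exact Measurable.aestronglyMeasurable (by fun_prop)
  refine ⟨fun w => (‖herm w e‖ : ℂ) / herm w e, memLp_top_of_bound hm 1 hb, ?_,
    e, 1, he, norm_one, by simp⟩
  rw [normLinf, eLpNorm_exponent_top]
  refine eLpNormEssSup_le_of_ae_bound (C := 1) hb |>.trans (by simp)

lemma opNormZbar_eq_sharpConst {n : ℕ} (hn : 0 < n) {α : ℝ} (hα : 0 ≤ α) (hα' : α ≤ 2 * n + 3) :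
    opNormZbar n α = ENNReal.ofReal (sharpConst n α) := by
  refine le_antisymm (iSup₂_le fun f hf => iSup_le fun hf1 => blochZbar_le fun z hz =>
    gradZbar_berezin_le_sharpConst hn hα hα' hf hf1 hz) ?_
  obtain ⟨f, hf, hf1, hE⟩ := exists_isExtremalZbar hn
  exact ((ENNReal.ofReal_le_ofReal (sharpConst_le_norm_gradZbar hn (by linarith) hf hE)).trans
    (norm_gradZbar_zero_le_blochZbar _)).trans (blochZbar_le_opNormZbar hf hf1)

lemma continuousAt_norm_gradZbar {n : ℕ} (hn : 0 < n) {α : ℝ} (hα : -1 < α) {f : Cn n → ℂ}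
    (hf : MemLinf f) :
    ContinuousAt (fun z => (1 - ‖z‖ ^ 2) * ‖gradZbar (berezin n α f) z‖) 0 := by
  have h0 : unitBall n ∈ nhds (0 : Cn n) := Metric.isOpen_ball.mem_nhds (by simp)
  have h1 : ContinuousAt (fderiv ℝ (berezin n α f)) 0 :=
    ((contDiffOn_berezin hn hα hf).continuousOn_fderiv_of_isOpen Metric.isOpen_ball
      le_rfl).continuousAt h0
  refine ContinuousAt.mul (by fun_prop) (ContinuousAt.norm ?_)
  refine (PiLp.continuous_toLp 2 _).continuousAt.comp (continuousAt_pi.2 fun j => ?_)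
  simp only [dx, dy]
  exact ((h1.clm_apply continuousAt_const).add (continuousAt_const.mul
    (h1.clm_apply continuousAt_const))).div_const 2

/-- For `α > 0` the seminorm can only be attained at the origin. -/
lemma norm_gradZbar_zero_eq_of_blochZbar_eq {n : ℕ} (hn : 0 < n) {α : ℝ} (hα : 0 < α)
    (hα' : α ≤ 2 * n + 3) {f : Cn n → ℂ} (hf : MemLinf f) (hf1 : normLinf f ≤ 1)
    (h : blochZbar (berezin n α f) = ENNReal.ofReal (sharpConst n α)) :
    ‖gradZbar (berezin n α f) 0‖ = sharpConst n α := by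
  have hle := gradZbar_berezin_le_sharpConst hn hα.le hα' hf hf1 (z := 0) (by simp)
  simp only [norm_zero, ne_eq, OfNat.ofNat_ne_zero, not_false_eq_true, zero_pow, sub_zero,
    one_mul] at hle
  by_contra hne
  have hlt := lt_of_le_of_ne hle hne
  obtain ⟨C₁, hC₁, hC₁'⟩ := exists_between hlt
  have hev := (continuousAt_norm_gradZbar hn (show -1 < α by linarith) hf).eventually_lt
    (continuousAt_const (y := C₁)) (by simpa using hC₁)
  obtain ⟨ε, hε, hball⟩ := Metric.eventually_nhds_iff_ball.1 hev
  set r := min ε 1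
  have hr : 0 < r := lt_min hε one_pos
  have hr1 : r ≤ 1 := min_le_right _ _
  obtain ⟨C₂, hC₂, hfar⟩ := exists_gradZbar_berezin_gap hn hα (ρ := r ^ 2) (by positivity)
    (by nlinarith) (Or.inl (by positivity))
  rw [upperConst_eq, kIndex_eq_zero hα', ← sharpConst_eq] at hC₂
  have hbound : blochZbar (berezin n α f) ≤ ENNReal.ofReal (max C₁ C₂) := by
    refine blochZbar_le fun z hz => ?_
    rcases lt_or_ge ‖z‖ r with hzr | hzr
    · exact (hball z (mem_ball_zero_iff.2 (hzr.trans_le (min_le_left _ _)))).le.trans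
        (le_max_left _ _)
    · exact (hfar f hf hf1 z hz (pow_le_pow_left₀ hr.le hzr 2)).trans (le_max_right _ _)
  rw [h, ENNReal.ofReal_le_ofReal_iff'] at hbound
  have hpos := sharpConst_pos n (show -1 < α by linarith)
  have := max_lt hC₁' hC₂
  rcases hbound with h | h <;> linarith

lemma opNormZbar_lt_upperConst {n : ℕ} (hn : 0 < n) {α : ℝ} (hα : 2 * n + 3 < α) :
    opNormZbar n α < ENNReal.ofReal (upperConst n α) := by
  have hα0 : 0 < α := lt_of_le_of_lt (by positivity) hα
  obtain ⟨C, hC, hbound⟩ := exists_gradZbar_berezin_gap hn hα0 le_rfl zero_le_one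
    (Or.inr (kIndex_pos hα))
  have hpos : 0 < upperConst n α := by
    rw [upperConst_eq]
    have := levelConst_pos n hα0 (kIndex n α)
    positivity
  refine lt_of_le_of_lt (b := ENNReal.ofReal C) (iSup₂_le fun f hf => iSup_le fun hf1 =>
    blochZbar_le fun z hz => hbound f hf hf1 z hz (sq_nonneg _)) ?_
  exact (ENNReal.ofReal_lt_ofReal_iff hpos).2 hC

/-- For `α < 0` the scalar integral is bounded below, by comparison of `ζ` with `-ζ`. -/
lemma moment_le_two_mul_integral {n : ℕ} (hn : 0 < n) {α : ℝ} (hα : -1 < α) (hα0 : α < 0)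
    {e z : Cn n} (he : ‖e‖ = 1) :
    moment n α 1 ≤ 2 * ∫ ζ, ‖(inner ℂ e ζ : ℂ)‖ * ‖1 - inner ℂ z ζ‖ ^ (-(2 * α))
      ∂(weighted n α) := by
  have hp : 0 ≤ -(2 * α) := by linarith
  have hi : ∀ z : Cn n, Integrable (fun ζ => ‖(inner ℂ e ζ : ℂ)‖ *
      ‖1 - inner ℂ z ζ‖ ^ (-(2 * α))) (weighted n α) := fun z =>
    integrable_weighted_of_continuous hn hα ((by fun_prop : Continuous _).mul
      ((Real.continuous_rpow_const hp).comp (by fun_prop)))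
  have hneg := (measurePreserving_weighted α (LinearIsometryEquiv.neg ℂ (E := Cn n))).integral_comp
    (LinearIsometryEquiv.neg ℂ (E := Cn n)).toHomeomorph.measurableEmbedding
    (fun ζ => ‖(inner ℂ e ζ : ℂ)‖ * ‖1 - inner ℂ z ζ‖ ^ (-(2 * α)))
  simp only [LinearIsometryEquiv.coe_neg, inner_neg_right, norm_neg] at hneg
  rw [two_mul]
  nth_rewrite 1 [← hneg]
  have hi' := hi (-z)
  simp only [inner_neg_left] at hi'
  rw [← integral_add hi' (hi z), ← integral_norm_inner hn hα he]
  refine integral_mono (integrable_weighted_of_continuous hn hα (by fun_prop)) (hi'.add (hi z))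
    fun ζ => ?_
  have hx : ∀ x : ℂ, 1 ≤ ‖1 - -x‖ ^ (-(2 * α)) + ‖1 - x‖ ^ (-(2 * α)) := fun x => by
    have h2 : 2 ≤ ‖1 - -x‖ + ‖1 - x‖ := by
      calc (2 : ℝ) = ‖(1 - -x) + (1 - x)‖ := by rw [show (1 - -x) + (1 - x) = 2 by ring]; simp
        _ ≤ _ := norm_add_le _ _
    rcases le_total 1 ‖1 - -x‖ with h | h
    · have := Real.one_le_rpow h hp
      have : 0 ≤ ‖1 - x‖ ^ (-(2 * α)) := by positivity
      linarith
    · have := Real.one_le_rpow (show 1 ≤ ‖1 - x‖ by linarith) hp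
      have : 0 ≤ ‖1 - -x‖ ^ (-(2 * α)) := by positivity
      linarith
  have := mul_le_mul_of_nonneg_left (hx (inner ℂ z ζ)) (norm_nonneg (inner ℂ e ζ : ℂ))
  change _ ≤ _ + _
  linarith

/-- For negative `α` the seminorm is at least a multiple of `(1 - r²)^α` for every `r < 1`. -/
lemma le_opNormZbar_of_neg {n : ℕ} (hn : 0 < n) {α : ℝ} (hα : -1 < α) (hα0 : α < 0) {r : ℝ}
    (hr0 : 0 ≤ r) (hr1 : r < 1) :
    ENNReal.ofReal ((1 - r ^ 2) ^ α * (sharpConst n α / 2)) ≤ opNormZbar n α := by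
  obtain ⟨e, he, -⟩ := exists_unit_smul hn (0 : Cn n)
  set z : Cn n := (r : ℂ) • e
  have hzr : ‖z‖ = r := by simp [z, norm_smul, he, abs_of_nonneg hr0]
  have hz : ‖z‖ < 1 := hzr ▸ hr1
  have hs : 0 < 1 - ‖z‖ ^ 2 := by nlinarith [norm_nonneg z]
  -- the function that aligns the phases of the integrand in the direction `e`
  set f : Cn n → ℂ := fun w => (‖(inner ℂ e (logGrad z w) : ℂ)‖ : ℂ) / inner ℂ e (logGrad z w)
  have hb : ∀ᵐ w ∂(ballVol n), ‖f w‖ ≤ 1 := ae_of_all _ fun w => norm_div_self_le_one _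
  have hm : AEStronglyMeasurable f (ballVol n) := by
    have : Measurable fun w => logGrad z w := by unfold logGrad; fun_prop
    exact Measurable.aestronglyMeasurable (by fun_prop)
  have hf : MemLinf f := memLp_top_of_bound hm 1 hb
  have hf1 : normLinf f ≤ 1 := by
    rw [normLinf, eLpNorm_exponent_top]
    exact (eLpNormEssSup_le_of_ae_bound (C := 1) hb).trans (by simp)
  refine le_trans ?_ ((le_blochZbar _ hz).trans (blochZbar_le_opNormZbar hf hf1))
  refine ENNReal.ofReal_le_ofReal ?_
  have hc := cConst_pos n hα
  have h1 := inner_gradZbar_berezin hn hα hf hz e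
  have h2 : ∀ w, f w * ((kernel z w : ℂ) * inner ℂ e (logGrad z w)) =
      ((kernel z w * ‖(inner ℂ e (logGrad z w) : ℂ)‖ : ℝ) : ℂ) := fun w => by
    rw [mul_left_comm, ofReal_norm_div_mul_self, Complex.ofReal_mul]
  simp_rw [h2] at h1
  rw [integral_complex_ofReal, ← Complex.ofReal_mul] at h1
  have h3 := norm_inner_le_norm (𝕜 := ℂ) e (gradZbar (berezin n α f) z)
  rw [h1, he, one_mul, Complex.norm_real] at h3
  have h4 := (le_abs_self _).trans h3
  have hcontr : contraction z e = e := by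
    by_cases hr : r = 0
    · have : z = 0 := by simp [z, hr]
      rw [this, contraction_apply]
      simp [defect]
    · have h := contraction_self hz
      simp only [z, map_smul] at h
      exact smul_right_injective _ (Complex.ofReal_ne_zero.2 hr) h
  have h5 := integral_kernel_mul_inner α hz e
  rw [hcontr] at h5
  have h6 := moment_le_two_mul_integral hn hα hα0 (z := z) he
  calc _ = cConst n α * (n + 1) * ((1 - ‖z‖ ^ 2) ^ α * (moment n α 1 / 2)) := by
        rw [sharpConst_eq_moment hα, hzr]; ring
    _ ≤ cConst n α * (n + 1) * ((1 - ‖z‖ ^ 2) ^ α * ∫ ζ, ‖(inner ℂ e ζ : ℂ)‖ *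
        ‖1 - inner ℂ z ζ‖ ^ (-(2 * α)) ∂(weighted n α)) := by gcongr; linarith
    _ = (1 - ‖z‖ ^ 2) * (cConst n α * (n + 1) *
        ∫ w, kernel z w * ‖(inner ℂ e (logGrad z w) : ℂ)‖ ∂(weighted n α)) := by
        rw [← h5]; ring
    _ ≤ _ := mul_le_mul_of_nonneg_left h4 hs.le

lemma opNormZbar_eq_top {n : ℕ} (hn : 0 < n) {α : ℝ} (hα : -1 < α) (hα0 : α < 0) :
    opNormZbar n α = ⊤ := by
  refine ENNReal.eq_top_of_forall_nnreal_le fun M => ?_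
  have hS := sharpConst_pos n hα
  -- `t = 1 - r²` is chosen so that `t ^ α = q`, and `q * (sharpConst n α / 2)` exceeds `M`
  set q : ℝ := (M + 1) / (sharpConst n α / 2) + 1
  have hq : 1 < q := by
    have : 0 < (M + 1 : ℝ) / (sharpConst n α / 2) := by positivity
    simp only [q]
    linarith
  set t : ℝ := q ^ (1 / α)
  have ht0 : 0 < t := Real.rpow_pos_of_pos (by linarith) _
  have ht1 : t < 1 := Real.rpow_lt_one_of_one_lt_of_neg hq (one_div_neg.2 hα0)
  have htα : t ^ α = q := by
    rw [← Real.rpow_mul (by linarith), one_div_mul_cancel hα0.ne, Real.rpow_one]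
  have h := le_opNormZbar_of_neg hn hα hα0 (Real.sqrt_nonneg (1 - t))
    (by rw [Real.sqrt_lt' one_pos]; linarith)
  rw [Real.sq_sqrt (by linarith), sub_sub_cancel, htα] at h
  refine le_trans ?_ h
  rw [← ENNReal.ofReal_coe_nnreal]
  refine ENNReal.ofReal_le_ofReal ?_
  simp only [q]
  rw [add_mul, div_mul_cancel₀ _ (by positivity)]
  linarith

/-- The conjugate gradient is dominated by the real gradient. -/
lemma norm_gradZbar_le_realGradNorm {n : ℕ} (g : Cn n → ℂ) (z : Cn n) :
    ‖gradZbar g z‖ ≤ realGradNorm g z := by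
  rw [EuclideanSpace.norm_eq, realGradNorm]
  refine Real.sqrt_le_sqrt (Finset.sum_le_sum fun j _ => ?_)
  simp only [gradZbar]
  have h1 : ‖(dx g z j + Complex.I * dy g z j) / 2‖ ≤ (‖dx g z j‖ + ‖dy g z j‖) / 2 := by
    rw [norm_div, Complex.norm_ofNat]
    have := norm_add_le (dx g z j) (Complex.I * dy g z j)
    rw [norm_mul, Complex.norm_I, one_mul] at this
    linarith
  have h2 := pow_le_pow_left₀ (norm_nonneg _) h1 2
  nlinarith [sq_nonneg (‖dx g z j‖ - ‖dy g z j‖), sq_nonneg (‖dx g z j‖), sq_nonneg (‖dy g z j‖)]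

lemma blochZbar_le_blochNorm {n : ℕ} (g : Cn n → ℂ) : blochZbar g ≤ blochNorm g := by
  refine le_trans (iSup₂_mono fun z hz => ENNReal.ofReal_le_ofReal ?_) le_add_self
  have hz1 : ‖z‖ < 1 := mem_ball_zero_iff.1 hz
  exact mul_le_mul_of_nonneg_left (norm_gradZbar_le_realGradNorm g z)
    (by nlinarith [norm_nonneg z])

lemma not_isBoundedToBloch {n : ℕ} (hn : 0 < n) {α : ℝ} (hα : -1 < α) (hα0 : α < 0) :
    ¬ IsBoundedToBloch n α := by
  rintro ⟨M, hM⟩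
  have h : opNormZbar n α ≤ M := iSup₂_le fun f hf => iSup_le fun hf1 =>
    ((blochZbar_le_blochNorm _).trans (hM f hf).2).trans (by
      calc (M : ℝ≥0∞) * normLinf f ≤ M * 1 := by gcongr
        _ = M := mul_one _)
  rw [opNormZbar_eq_top hn hα hα0] at h
  exact absurd h (by simp)

lemma berezin_conj {n : ℕ} (α : ℝ) (f : Cn n → ℂ) :
    berezin n α (fun w => conj (f w)) = fun z => conj (berezin n α f z) := by
  ext z
  rw [berezin, berezin, map_mul, Complex.conj_ofReal, ← integral_conj]
  simp only [map_mul, Complex.conj_ofReal]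

lemma gradZbar_conj {n : ℕ} (g : Cn n → ℂ) (z : Cn n) (j : Fin n) :
    gradZbar (fun z => conj (g z)) z j = conj (gradZ g z j) := by
  have h : ∀ v, fderiv ℝ (fun z => conj (g z)) z v = conj (fderiv ℝ g z v) := fun v => by
    have := Complex.conjCLE.comp_fderiv (f := g) (x := z)
    exact DFunLike.congr_fun this v
  simp only [gradZbar, gradZ, dx, dy, h, map_div₀, map_sub, map_mul, Complex.conj_I]
  rw [show conj (2 : ℂ) = 2 from Complex.conj_ofNat 2]
  ring

lemma norm_gradZbar_conj {n : ℕ} (g : Cn n → ℂ) (z : Cn n) :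
    ‖gradZbar (fun z => conj (g z)) z‖ = ‖gradZ g z‖ := by
  rw [EuclideanSpace.norm_eq, EuclideanSpace.norm_eq]
  simp only [gradZbar_conj, RCLike.norm_conj]

lemma norm_gradZ_berezin {n : ℕ} (α : ℝ) (f : Cn n → ℂ) (z : Cn n) :
    ‖gradZ (berezin n α f) z‖ = ‖gradZbar (berezin n α fun w => conj (f w)) z‖ := by
  rw [berezin_conj, norm_gradZbar_conj]

lemma blochZ_berezin {n : ℕ} (α : ℝ) (f : Cn n → ℂ) :
    blochZ (berezin n α f) = blochZbar (berezin n α fun w => conj (f w)) := by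
  simp only [blochZ, blochZbar, norm_gradZ_berezin]

lemma MemLinf.conj {n : ℕ} {f : Cn n → ℂ} (hf : MemLinf f) : MemLinf fun w => conj (f w) :=
  MemLp.star hf

lemma normLinf_conj {n : ℕ} (f : Cn n → ℂ) : normLinf (fun w => conj (f w)) = normLinf f :=
  eLpNorm_congr_norm_ae (ae_of_all _ fun _ => RCLike.norm_conj _)

lemma opNormZ_eq_opNormZbar (n : ℕ) (α : ℝ) : opNormZ n α = opNormZbar n α := by
  refine le_antisymm (iSup₂_le fun f hf => iSup_le fun hf1 => ?_)
    (iSup₂_le fun f hf => iSup_le fun hf1 => ?_)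
  · rw [blochZ_berezin]
    exact blochZbar_le_opNormZbar hf.conj ((normLinf_conj f).trans_le hf1)
  · refine le_iSup₂_of_le _ hf.conj (le_iSup_of_le ((normLinf_conj f).trans_le hf1) ?_)
    rw [blochZ_berezin]
    simp

lemma isExtremalZbar_conj_iff {n : ℕ} (f : Cn n → ℂ) :
    IsExtremalZbar (fun w => conj (f w)) ↔ IsExtremalZ f := by
  constructor
  · rintro ⟨a, C, ha, hC, h⟩
    refine ⟨a, conj C, ha, by simpa using hC, ?_⟩
    filter_upwards [h] with w hw
    rw [← Complex.conj_conj (f w), hw]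
    simp
  · rintro ⟨a, C, ha, hC, h⟩
    refine ⟨a, conj C, ha, by simpa using hC, ?_⟩
    filter_upwards [h] with w hw
    rw [hw]
    simp

lemma sharpConst_eq_integral {n : ℕ} (hn : 0 < n) {α : ℝ} (hα : -1 < α) :
    sharpConst n α =
      cConst n α * (n + 1) * (∫ ζ, ‖ζ ⟨0, hn⟩‖ * (1 - ‖ζ‖ ^ 2) ^ α ∂(ballVol n)) := by
  rw [sharpConst_eq_moment hα, ← integral_norm_inner hn hα
    (e := EuclideanSpace.single ⟨0, hn⟩ 1) (by simp), integral_weighted]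
  congr 2
  ext ζ
  rw [EuclideanSpace.inner_single_left, smul_eq_mul]
  simp [mul_comm]

/-- The characterizations of the extremal functions, for the conjugate gradient. -/
lemma extremal_characterization {n : ℕ} (hn : 0 < n) {α : ℝ} (hα : 0 ≤ α) (hα' : α ≤ 2 * n + 3)
    {f : Cn n → ℂ} (hf : MemLinf f) (hf1 : normLinf f ≤ 1) :
    (‖gradZbar (berezin n α f) 0‖ = sharpConst n α ↔ IsExtremalZbar f) ∧
      (IsExtremalZbar f → blochZbar (berezin n α f) = ENNReal.ofReal (sharpConst n α)) ∧
      (0 < α → (blochZbar (berezin n α f) = ENNReal.ofReal (sharpConst n α) ↔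
        IsExtremalZbar f)) := by
  have hα1 : -1 < α := by linarith
  have hle : blochZbar (berezin n α f) ≤ ENNReal.ofReal (sharpConst n α) :=
    blochZbar_le fun z hz => gradZbar_berezin_le_sharpConst hn hα hα' hf hf1 hz
  have h0 : ‖gradZbar (berezin n α f) 0‖ ≤ sharpConst n α := by
    simpa using gradZbar_berezin_le_sharpConst hn hα hα' hf hf1 (z := 0) (by simp)
  have hE : IsExtremalZbar f → blochZbar (berezin n α f) = ENNReal.ofReal (sharpConst n α) :=
    fun hE => le_antisymm hle ((ENNReal.ofReal_le_ofReal
      (sharpConst_le_norm_gradZbar hn hα1 hf hE)).trans (norm_gradZbar_zero_le_blochZbar _))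
  refine ⟨⟨isExtremalZbar_of_norm_gradZbar hn hα1 hf hf1,
    fun hE => le_antisymm h0 (sharpConst_le_norm_gradZbar hn hα1 hf hE)⟩, hE, fun hpos =>
    ⟨fun h => isExtremalZbar_of_norm_gradZbar hn hα1 hf hf1
      (norm_gradZbar_zero_eq_of_blochZbar_eq hn hpos hα' hf hf1 h), hE⟩⟩

end BerezinBloch
end

open BerezinBloch
theorem theorem1 (n : ℕ) (hn : 0 < n) (α : ℝ) (hα : -1 < α) :
    -- `B_α f` is a `C¹` function on the ball for every `f` in `L^∞`
    (∀ f : Cn n → ℂ, MemLinf f → ContDiffOn ℝ 1 (berezin n α f) (unitBall n)) ∧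
    -- (i)
    (0 ≤ α → α ≤ 2 * n + 3 →
      opNormZ n α = ENNReal.ofReal (sharpConst n α) ∧
      opNormZbar n α = ENNReal.ofReal (sharpConst n α) ∧
      sharpConst n α =
        cConst n α * (n + 1) * (∫ ζ, ‖ζ ⟨0, hn⟩‖ * (1 - ‖ζ‖ ^ 2) ^ α ∂(ballVol n)) ∧
      ∀ f : Cn n → ℂ, MemLinf f → normLinf f = 1 →
        (‖gradZ (berezin n α f) 0‖ = sharpConst n α ↔ IsExtremalZ f) ∧
        (IsExtremalZ f → blochZ (berezin n α f) = ENNReal.ofReal (sharpConst n α)) ∧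
        (0 < α →
          (blochZ (berezin n α f) = ENNReal.ofReal (sharpConst n α) ↔ IsExtremalZ f)) ∧
        (‖gradZbar (berezin n α f) 0‖ = sharpConst n α ↔ IsExtremalZbar f) ∧
        (IsExtremalZbar f →
          blochZbar (berezin n α f) = ENNReal.ofReal (sharpConst n α)) ∧
        (0 < α →
          (blochZbar (berezin n α f) = ENNReal.ofReal (sharpConst n α) ↔
            IsExtremalZbar f))) ∧
    -- (ii)
    (α < 0 → opNormZ n α = ⊤ ∧ opNormZbar n α = ⊤ ∧ ¬ IsBoundedToBloch n α) ∧
    -- (iii)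
    (2 * n + 3 < α →
      opNormZ n α < ENNReal.ofReal (upperConst n α) ∧
      opNormZbar n α < ENNReal.ofReal (upperConst n α)) := by
  refine ⟨fun f hf => contDiffOn_berezin hn hα hf, fun hα0 hα' => ?_, fun hα0 => ?_, fun hα' => ?_⟩
  · refine ⟨?_, opNormZbar_eq_sharpConst hn hα0 hα', sharpConst_eq_integral hn hα,
      fun f hf hf1 => ?_⟩
    · rw [opNormZ_eq_opNormZbar, opNormZbar_eq_sharpConst hn hα0 hα']
    · obtain ⟨h1, h2, h3⟩ := extremal_characterization hn hα0 hα' hf hf1.le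
      obtain ⟨h4, h5, h6⟩ := extremal_characterization hn hα0 hα' hf.conj
        ((normLinf_conj f).trans hf1).le
      rw [isExtremalZbar_conj_iff, ← norm_gradZ_berezin] at h4
      rw [isExtremalZbar_conj_iff, ← blochZ_berezin] at h5 h6
      exact ⟨h4, h5, h6, h1, h2, h3⟩
  · refine ⟨?_, opNormZbar_eq_top hn hα hα0, not_isBoundedToBloch hn hα hα0⟩
    rw [opNormZ_eq_opNormZbar, opNormZbar_eq_top hn hα hα0]
  · rw [opNormZ_eq_opNormZbar]
    exact ⟨opNormZbar_lt_upperConst hn hα', opNormZbar_lt_upperConst hn hα'⟩
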